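/- Let $r\ge 2$, let $\mathbb F=\langle a_1,\dots,a_r\rangle$ be the free group of rank $r$ and $S=\{a_1^{\pm1},\dots,a_r^{\pm1}\}$. Let $\partial\mathbb F$ be the space of sequences $\xi=(\xi_1,\xi_2,\dots)\in S^{\mathbb N}$ with $\xi_{i+1}\neq \xi_i^{-1}$ for all $i\ge 1$, and let $\nu$ be the Borel probability measure on $\partial\mathbb F$ with $$\nu(\{\xi:\ \xi_i=t_i\ \text{for } 1\le i\le n\})=(2r)^{-1}(2r-1)^{-(n-1)}$$ for all $n\ge 1$ and all $t_1,\dots,t_n\in S$ with $t_{i+1}\ne t_i^{-1}$. Let $\mathcal R_0$ be the tail equivalence relation on $\partial\mathbb F$: $(\xi,\eta)\in\mathcal R_0$ iff there is $N$ with $\xi_n=\eta_n$ for all $n\ge N$. Put $\mathcal B_n(\xi)=\{\eta\in\partial\mathbb F:\ \eta_k=\xi_k\ \text{for all } k>n\}$, a finite set. Let $\alpha:\mathcal R_0\to\mathbb F$ be the cocycle $\alpha(\xi,\eta)=(\xi_1\cdots\xi_N)(\eta_1\cdots\eta_N)^{-1}$, for any $N$ such that $\xi_n=\eta_n$ for all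 $n\ge N$ (the value does not depend on $N$, and $\alpha(\xi,\eta)\eta=\xi$ for the natural action of $\mathbb F$ on $\partial\mathbb F$). Let $(X,\lambda)$ be a standard $\sigma$-finite measure space on which $\mathbb F$ acts by non-singular transformations. Put $B=\partial\mathbb F\times X$ and $\mu=\nu\times\lambda$. Let $\mathcal R_0^\alpha$ be the equivalence relation on $B$ given by $(\xi,x)\sim(\xi',x')$ iff $(\xi,\xi')\in\mathcal R_0$ and $\alpha(\xi',\xi)x=x'$, and put $$\mathcal B_n^\alpha(\xi,x)=\{(\xi',x'):\ \xi'\in\mathcal B_n(\xi),\ x'=\alpha(\xi',\xi)x\}.$$ Let $M$ be the measure on $\mathcal R_0^\alpha$ obtained by integrating with respect to $\mu$ the counting measures on the fibers of $(p,q)\mapsto p$, let $\check M$ be its image under $(p,q)\mapsto(q,p)$, and let $D(p,q)=\frac{dM}{d\check M}(p,q)$ be the Radon--Nikodym cocycle of $\mathcal R_0^\alpha$. For functions $u,v$ on $B$ put $$\mathrm{RATIO}_n[u,v](p)=\frac{\sum_{q\in\mathcal B_n^\alpha(p)}u(q)D(q,p)}{\sum_{q\in\mathcal B_n^\alpha(p)}v(q)D(q,p)}.$$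 Then $(\mathcal B^\alpha_n)_{n\ge1}$ is a ratio ergodic sequence in $L^1$: for all real-valued $u,v\in L^1(B,\mu)$ with $v>0$ almost everywhere, $\mathrm{RATIO}_n[u,v]$ converges $\mu$-almost everywhere, as $n\to\infty$, to $$\mathbb E_{\mu_v}\!\left[\tfrac uv\,\middle|\,\mathcal R_0^\alpha\right],$$ the conditional expectation of $u/v$, with respect to the finite measure $d\mu_v=v\,d\mu$, on the $\sigma$-algebra of $\mathcal R_0^\alpha$-invariant measurable sets. -/

import Mathlib

open MeasureTheory Filter Topology
open scoped ENNReal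

/-! ### The free group of rank `r` and its boundary -/

/-- The symmetric generating set `S = {a₁^{±1}, …, a_r^{±1}}` of the free group: the letter
`(i, true)` stands for `aᵢ` and `(i, false)` for `aᵢ⁻¹`, as in `FreeGroup (Fin r)`. -/
abbrev Letter (r : ℕ) : Type := Fin r × Bool

/-- The inverse letter. -/
def letterInv {r : ℕ} (s : Letter r) : Letter r := (s.1, !s.2)

theorem letterInv_letterInv {r : ℕ} (s : Letter r) : letterInv (letterInv s) = s := by
  simp [letterInv]

/-- The boundary of the free group: infinite reduced words, with the Borel structure of a
subspace of the product `S^ℕ`. The letter `ξ i` is the `(i + 1)`-st letter of the word. -/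
abbrev Boundary (r : ℕ) : Type :=
  {ξ : ℕ → Letter r // ∀ i, ξ (i + 1) ≠ letterInv (ξ i)}

/-! ### The Markov measure on the boundary -/

/-- An enumeration of the `2 r - 1` letters that may follow the letter `s` in a reduced word
(`2 (r - 1) + 1 = 2 r - 1`, since `r ≥ 1` as soon as there is a letter). -/
noncomputable def nextLetter {r : ℕ} (s : Letter r) :
    Fin (2 * (r - 1) + 1) ≃ {t : Letter r // t ≠ letterInv s} :=
  (Fintype.equivFinOfCardEq (by
    have h : 0 < r := s.1.pos
    rw [Fintype.card_subtype_compl, Fintype.card_subtype_eq]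
    simp only [Fintype.card_prod, Fintype.card_fin, Fintype.card_bool]
    omega)).symm

/-- The letters of the path with first letter `p.1` and successive choices `p.2`. -/
noncomputable def pathLetter {r : ℕ} (p : Letter r × (ℕ → Fin (2 * (r - 1) + 1))) :
    ℕ → Letter r
  | 0 => p.1
  | n + 1 => (nextLetter (pathLetter p n) (p.2 n)).1

/-- The path as a point of the boundary. -/
noncomputable def path {r : ℕ} (p : Letter r × (ℕ → Fin (2 * (r - 1) + 1))) : Boundary r :=
  ⟨pathLetter p, fun i => (nextLetter (pathLetter p i) (p.2 i)).2⟩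

/-- The Markov measure `ν` on the boundary: the law of a random infinite reduced word whose first
letter is uniform in `S` and each of whose further letters is uniform among the `2 r - 1` letters
different from the inverse of the preceding one. See `boundaryMeasure_cylinder`. -/
noncomputable def boundaryMeasure (r : ℕ) : Measure (Boundary r) :=
  ((ProbabilityTheory.uniformOn (Set.univ : Set (Letter r))).prod
    (Measure.infinitePi fun _ : ℕ =>
      ProbabilityTheory.uniformOn (Set.univ : Set (Fin (2 * (r - 1) + 1))))).map path

theorem measurable_path {r : ℕ} : Measurable (path (r := r)) := by
  refine Measurable.subtype_mk (measurable_pi_iff.2 fun n => ?_)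
  induction n with
  | zero => exact measurable_fst
  | succ n ih =>
    have h : Measurable fun q : Letter r × Fin (2 * (r - 1) + 1) => (nextLetter q.1 q.2).1 :=
      measurable_of_countable _
    have h2 : Measurable fun p : Letter r × (ℕ → Fin (2 * (r - 1) + 1)) => p.2 n :=
      (measurable_pi_apply n).comp measurable_snd
    exact h.comp (g := fun q : Letter r × Fin (2 * (r - 1) + 1) => (nextLetter q.1 q.2).1)
      (f := fun p => (pathLetter p n, p.2 n)) (Measurable.prodMk ih h2)

/-- The cylinder of a reduced word of length `n + 1` has measure `(2 r)⁻¹ (2 r - 1)⁻ⁿ`; together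
with the extension theorem this characterizes `ν`. -/
theorem boundaryMeasure_cylinder {r : ℕ} (t : ℕ → Letter r) (n : ℕ)
    (ht : ∀ i < n, t (i + 1) ≠ letterInv (t i)) :
    boundaryMeasure r {ξ | ∀ i ≤ n, ξ.1 i = t i} =
      ((2 * r : ℕ) : ℝ≥0∞)⁻¹ * (((2 * r - 1 : ℕ) : ℝ≥0∞)⁻¹) ^ n := by
  have hr : 0 < r := (t 0).1.pos
  have hms : MeasurableSet {ξ : Boundary r | ∀ i ≤ n, ξ.1 i = t i} := by
    have : {ξ : Boundary r | ∀ i ≤ n, ξ.1 i = t i} =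
        ⋂ i, ⋂ (_ : i ≤ n), {ξ : Boundary r | ξ.1 i = t i} := by
      ext; simp
    rw [this]
    refine MeasurableSet.iInter fun i => MeasurableSet.iInter fun _ => ?_
    have h : Measurable fun ξ : Boundary r => ξ.1 i :=
      (measurable_pi_apply i).comp measurable_subtype_coe
    exact h (measurableSet_singleton (t i))
  let c : ℕ → Fin (2 * (r - 1) + 1) := fun i =>
    if h : t (i + 1) ≠ letterInv (t i) then (nextLetter (t i)).symm ⟨t (i + 1), h⟩ else 0
  have hc : ∀ i < n, ∀ k, (nextLetter (t i) k).1 = t (i + 1) ↔ k = c i := by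
    intro i hi k
    simp only [c, dif_pos (ht i hi), Equiv.eq_symm_apply, Subtype.ext_iff]
  have hpre : path ⁻¹' {ξ : Boundary r | ∀ i ≤ n, ξ.1 i = t i} =
      {t 0} ×ˢ (Set.pi (Finset.range n : Set ℕ) fun i => {c i}) := by
    ext p
    simp only [Set.mem_preimage, Set.mem_ofPred_eq, Set.mem_prod, Set.mem_singleton_iff,
      Set.mem_pi, Finset.mem_coe, Finset.mem_range]
    constructor
    · intro h
      refine ⟨h 0 (Nat.zero_le _), fun i hi => ?_⟩
      rw [← hc i hi]
      have h1 := h i hi.le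
      have h2 := h (i + 1) hi
      simp only [path, pathLetter] at h1 h2
      rwa [h1] at h2
    · rintro ⟨h0, h⟩ i
      induction i with
      | zero => exact fun _ => h0
      | succ i ih =>
        intro hi
        have h1 := ih (by omega)
        simp only [path, pathLetter] at h1 ⊢
        rw [h1, hc i hi]
        exact h i hi
  rw [boundaryMeasure, Measure.map_apply measurable_path hms, hpre, Measure.prod_prod,
    Measure.infinitePi_pi _ (fun i _ => measurableSet_singleton _)]
  have hcard : 2 * r - 1 = 2 * (r - 1) + 1 := by omega
  rw [hcard]
  simp [ProbabilityTheory.uniformOn_univ, mul_comm]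

/-! ### The tail relation, its cocycle and the horospherical subset functions -/

/-- The tail equivalence relation `R₀` on the boundary. -/
def TailRel {r : ℕ} (ξ η : Boundary r) : Prop := ∃ N, ∀ n ≥ N, ξ.1 n = η.1 n

/-- The element `ξ₁ ⋯ ξ_N` of the free group. -/
def prefixElt {r : ℕ} (ξ : Boundary r) (N : ℕ) : FreeGroup (Fin r) :=
  FreeGroup.mk ((List.range N).map ξ.1)

open scoped Classical in
/-- The cocycle `α : R₀ → 𝔽`, `α(ξ, η) = (ξ₁ ⋯ ξ_N) (η₁ ⋯ η_N)⁻¹` for any `N` from which on the two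
words agree (see `tailCocycle_eq` and `boundaryAction_tailCocycle`). Its value off `R₀` is
irrelevant. -/
noncomputable def tailCocycle {r : ℕ} (ξ η : Boundary r) : FreeGroup (Fin r) :=
  if h : TailRel ξ η then prefixElt ξ h.choose * (prefixElt η h.choose)⁻¹ else 1

theorem prefixElt_succ {r : ℕ} (ξ : Boundary r) (N : ℕ) :
    prefixElt ξ (N + 1) = prefixElt ξ N * FreeGroup.mk [ξ.1 N] := by
  simp [prefixElt, List.range_succ, FreeGroup.mul_mk]

theorem tailCocycle_eq {r : ℕ} {ξ η : Boundary r} {N : ℕ} (h : ∀ n ≥ N, ξ.1 n = η.1 n) :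
    tailCocycle ξ η = prefixElt ξ N * (prefixElt η N)⁻¹ := by
  have key : ∀ M, (∀ n ≥ M, ξ.1 n = η.1 n) → ∀ k,
      prefixElt ξ (M + k) * (prefixElt η (M + k))⁻¹ = prefixElt ξ M * (prefixElt η M)⁻¹ := by
    intro M hM k
    induction k with
    | zero => rfl
    | succ k ih =>
      rw [← add_assoc, prefixElt_succ, prefixElt_succ, hM (M + k) (by omega), ← ih]
      group
  have hT : TailRel ξ η := ⟨N, h⟩
  rw [tailCocycle, dif_pos hT, ← key _ hT.choose_spec N, ← key _ h hT.choose, add_comm]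

/-- Left multiplication of an infinite reduced word by a letter, with cancellation. -/
def letterAct {r : ℕ} (s : Letter r) (ξ : Boundary r) : Boundary r :=
  if h : ξ.1 0 = letterInv s then ⟨fun i => ξ.1 (i + 1), fun i => ξ.2 (i + 1)⟩
  else ⟨fun i => Nat.casesOn i s ξ.1, fun i => by
    cases i with
    | zero => exact h
    | succ i => exact ξ.2 i⟩

theorem letterAct_letterInv {r : ℕ} (s : Letter r) (ξ : Boundary r) :
    letterAct (letterInv s) (letterAct s ξ) = ξ := by
  by_cases h : ξ.1 0 = letterInv s
  · have h1 : letterAct s ξ = ⟨fun i => ξ.1 (i + 1), fun i => ξ.2 (i + 1)⟩ := by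
      simp [letterAct, h]
    have h2 : ξ.1 1 ≠ letterInv (letterInv s) := by
      rw [← h]; exact ξ.2 0
    rw [h1]
    unfold letterAct
    rw [dif_neg h2]
    apply Subtype.ext
    funext i
    cases i with
    | zero => exact h.symm
    | succ i => rfl
  · have h1 : letterAct s ξ = ⟨fun i => Nat.casesOn i s ξ.1, fun i => by
        cases i with
        | zero => exact h
        | succ i => exact ξ.2 i⟩ := by
      unfold letterAct
      rw [dif_neg h]
    rw [h1]
    unfold letterAct
    exact dif_pos (letterInv_letterInv s).symm

/-- The action of the free group on its boundary. -/
def boundaryAction (r : ℕ) : FreeGroup (Fin r) →* Equiv.Perm (Boundary r) :=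
  FreeGroup.lift fun i =>
    { toFun := letterAct (i, true)
      invFun := letterAct (i, false)
      left_inv := letterAct_letterInv (i, true)
      right_inv := letterAct_letterInv (i, false) }

theorem boundaryAction_letter {r : ℕ} (s : Letter r) (ξ : Boundary r) :
    boundaryAction r (FreeGroup.mk [s]) ξ = letterAct s ξ := by
  obtain ⟨i, b⟩ := s
  cases b <;> simp [boundaryAction, FreeGroup.lift_mk] <;> rfl

/-- Indeed `α(ξ, η) η = ξ`. -/
theorem boundaryAction_tailCocycle {r : ℕ} {ξ η : Boundary r} (h : TailRel ξ η) :
    boundaryAction r (tailCocycle ξ η) η = ξ := by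
  have key : ∀ (ζ : Boundary r) (N : ℕ),
      boundaryAction r (prefixElt ζ N)
        ⟨fun i => ζ.1 (N + i), fun i => ζ.2 (N + i)⟩ = ζ := by
    intro ζ N
    induction N with
    | zero => simp [prefixElt, ← FreeGroup.one_eq_mk]
    | succ N ih =>
      rw [prefixElt_succ, map_mul, Equiv.Perm.mul_apply, boundaryAction_letter]
      refine Eq.trans (congrArg _ ?_) ih
      unfold letterAct
      rw [dif_neg (by exact ζ.2 N)]
      apply Subtype.ext
      funext i
      cases i with
      | zero => rfl
      | succ i => exact congrArg ζ.1 (by omega)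
  obtain ⟨N, hN⟩ := h
  rw [tailCocycle_eq hN, map_mul, map_inv, Equiv.Perm.mul_apply]
  have h1 : (boundaryAction r (prefixElt η N))⁻¹ η =
      ⟨fun i => η.1 (N + i), fun i => η.2 (N + i)⟩ := by
    rw [Equiv.Perm.inv_eq_iff_eq, key]
  have h2 : (⟨fun i => η.1 (N + i), fun i => η.2 (N + i)⟩ : Boundary r) =
      ⟨fun i => ξ.1 (N + i), fun i => ξ.2 (N + i)⟩ :=
    Subtype.ext (funext fun i => (hN (N + i) (by omega)).symm)
  rw [h1, h2, key]

theorem finite_tailSet {r : ℕ} (n : ℕ) (ξ : Boundary r) :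
    {η : Boundary r | ∀ k ≥ n, η.1 k = ξ.1 k}.Finite := by
  refine Set.Finite.of_finite_image (f := fun η (i : Fin n) => η.1 i) (Set.toFinite _) ?_
  intro η hη ζ hζ h
  apply Subtype.ext
  funext k
  by_cases hk : k < n
  · exact congrFun h ⟨k, hk⟩
  · rw [hη k (by omega), hζ k (by omega)]

/-- The horospherical subset functions `B_n(ξ) = {η : η_k = ξ_k for all k > n}` (letters numbered
from `1`, hence `k ≥ n` in the numbering from `0`). -/
noncomputable def horoSubset (r n : ℕ) (ξ : Boundary r) : Finset (Boundary r) :=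
  (finite_tailSet n ξ).toFinset

/-! ### Measured equivalence relations, cocycle extensions and ratios -/

/-- The left counting measure `M` of a relation `R` with countable classes: the integral over `μ`
of the counting measures on the fibers of `(x, y) ↦ x`. -/
noncomputable def leftCountingMeasure {B : Type*} [MeasurableSpace B] (μ : Measure B)
    (R : B → B → Prop) : Measure (B × B) :=
  μ.bind fun x => Measure.sum fun y : {y : B // R x y} => Measure.dirac (x, y.1)

/-- The right counting measure, the image of `M` under `(x, y) ↦ (y, x)`. -/
noncomputable def rightCountingMeasure {B : Type*} [MeasurableSpace B] (μ : Measure B)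
    (R : B → B → Prop) : Measure (B × B) :=
  (leftCountingMeasure μ R).map Prod.swap

/-- The Radon-Nikodym cocycle `D(x, y)`, the density of the left counting measure with respect to
the right one. -/
noncomputable def rnCocycle {B : Type*} [MeasurableSpace B] (μ : Measure B)
    (R : B → B → Prop) (x y : B) : ℝ :=
  ((leftCountingMeasure μ R).rnDeriv (rightCountingMeasure μ R) (x, y)).toReal

/-- The sums `∑_{b' ∈ F_n(b)} u(b') D(b', b)`. -/
noncomputable def relSum {B : Type*} [MeasurableSpace B] (μ : Measure B) (R : B → B → Prop)
    (F : ℕ → B → Finset B) (n : ℕ) (u : B → ℝ) (b : B) : ℝ :=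
  ∑ b' ∈ F n b, u b' * rnCocycle μ R b' b

/-- The ratios of the sums of `u` and of `v`. -/
noncomputable def relRatio {B : Type*} [MeasurableSpace B] (μ : Measure B) (R : B → B → Prop)
    (F : ℕ → B → Finset B) (n : ℕ) (u v : B → ℝ) (b : B) : ℝ :=
  relSum μ R F n u b / relSum μ R F n v b

/-- The `σ`-algebra of `R`-invariant measurable sets. -/
@[reducible]
def invariantSigma {B : Type*} [m : MeasurableSpace B] (R : B → B → Prop) :
    MeasurableSpace B where
  MeasurableSet' A := MeasurableSet[m] A ∧ ∀ x y, R x y → (x ∈ A ↔ y ∈ A)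
  measurableSet_empty := ⟨MeasurableSet.empty, fun _ _ _ => Iff.rfl⟩
  measurableSet_compl A hA := ⟨hA.1.compl, fun x y h => not_congr (hA.2 x y h)⟩
  measurableSet_iUnion A hA := ⟨MeasurableSet.iUnion fun i => (hA i).1, fun x y h => by
    simp only [Set.mem_iUnion]
    exact exists_congr fun i => (hA i).2 x y h⟩

/-- The extension `R^α` of `R` to `B × X`: `(b, x) ∼ (b', x')` iff `(b, b') ∈ R` and
`α(b', b) x = x'`. -/
def extRel {B X Γ : Type*} [SMul Γ X] (R : B → B → Prop) (α : B → B → Γ) (p q : B × X) : Prop :=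
  R p.1 q.1 ∧ α q.1 p.1 • p.2 = q.2

/-- The pulled back subset functions
`F_n^α(b, x) = {(b', x') : b' ∈ F_n(b), x' = α(b', b) x}`. -/
def extSubset {B X Γ : Type*} [SMul Γ X] (α : B → B → Γ) (F : ℕ → B → Finset B) (n : ℕ)
    (p : B × X) : Finset (B × X) :=
  (F n p.1).map ⟨fun b' => (b', α b' p.1 • p.2), fun _ _ h => (Prod.ext_iff.1 h).1⟩

/-!
The sets `B_n^α(p)` are the classes of finite equivalence relations `R_n` that increase to `R₀^α`.
Therefore the `σ`-algebras of `R_n`-invariant sets decrease to that of the `R₀^α`-invariant sets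
(`iInf_invariantSigma`), and the theorem consists of two facts.

* The ratio is a conditional expectation: `RATIO_n[u, v] = E_{μ_v}[u / v | R_n]` almost everywhere
  (`ae_relRatio_eq_condExp`). Writing `S_n w (x) = ∑ w(y) D(y, x)`, sum over `y ∈ B_n^α(x)`, the
  definition of `D` as a density gives the mass transport formula
  `∫ g · S_n w dμ = ∫ w(x) ∑_{y ∈ B_n^α(x)} g(y) dμ(x)` (`IsFiniteSubrelation.lintegral_transport`),
  whose inner sum is an `R_n`-invariant function of `x`. Let `c` be the conditional expectation of
  `u / v`. Since `u` and `c v` have the same integrals against invariant functions, `S_n u` and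
  `S_n (c v)` agree, and `S_n (c v) = c · S_n v` because `c` is invariant
  (`IsFiniteSubrelation.ae_weighted_sum_eq`).
* Conditional expectations along a decreasing sequence of `σ`-algebras converge almost everywhere to
  the one on the intersection (`tendsto_ae_condExp_of_antitone`). Convergence in `L¹` comes from
  orthogonal projections in `L²`, and Doob's maximal inequality improves it to convergence almost
  everywhere.

For the density `D` to represent `M`, the left counting measure has to be `σ`-finite and absolutely
continuous with respect to the right one. Both follow from an enumeration of the classes by
countably many non-singular maps (`ClassEnumeration`). These are the diagonal maps
`(ξ, x) ↦ (g ξ, g x)`, restricted to the set where `α(g ξ, ξ) = g` (`tailEnumeration`). They are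
non-singular because each letter changes the measure of a cylinder by a factor `(2 r - 1)^{±1}`
(`map_letterAct_boundaryMeasure`).
-/

/-! ### Convergence of conditional expectations along decreasing σ-algebras -/

/-- Doob's weak-type inequality for a reverse martingale: over a finite horizon the reversed sequence
is a martingale, and the maximum over the horizon does not depend on the order. -/
theorem maximal_ineq_condExp_of_antitone {Ω : Type*} {m0 : MeasurableSpace Ω} {μ : Measure Ω}
    [IsFiniteMeasure μ] {m : ℕ → MeasurableSpace Ω} (hle : ∀ n, m n ≤ m0) (hm : Antitone m)
    (f : Ω → ℝ) (ε : NNReal) :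
    ε * μ {ω | ∃ n, (ε : ℝ) ≤ |(μ[f | m n]) ω|} ≤ eLpNorm f 1 μ := by
  have key : ∀ N, ε * μ {ω | ∃ n ≤ N, (ε : ℝ) ≤ |(μ[f | m n]) ω|} ≤ eLpNorm f 1 μ := by
    intro N
    -- The indices up to `N` in reverse order: a decreasing family becomes a filtration.
    let 𝒢 : Filtration ℕ m0 := ⟨fun k => m (N - k), fun i j hij => hm (by omega), fun k => hle _⟩
    have hY : Martingale (fun k => μ[f | 𝒢 k]) 𝒢 μ := martingale_condExp f 𝒢 μ
    have hsub : Submartingale (fun k => |μ[f | 𝒢 k]|) 𝒢 μ :=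
      hY.submartingale.sup hY.neg.submartingale
    have h := maximal_ineq hsub (fun k ω => abs_nonneg _) (ε := ε) N
    have hset : {ω | ∃ n ≤ N, (ε : ℝ) ≤ |(μ[f | m n]) ω|} =
        {ω | (ε : ℝ) ≤ (Finset.range (N + 1)).sup' Finset.nonempty_range_add_one
          fun k => |μ[f | 𝒢 k]| ω} := by
      ext ω
      simp only [Set.mem_ofPred_eq, Finset.le_sup'_iff, Finset.mem_range, Pi.abs_apply]
      constructor
      · rintro ⟨n, hn, h⟩
        refine ⟨N - n, by omega, ?_⟩
        change (ε : ℝ) ≤ |(μ[f | m (N - (N - n))]) ω|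
        rwa [show N - (N - n) = n by omega]
      · rintro ⟨k, hk, h⟩
        exact ⟨N - k, by omega, h⟩
    rw [hset]
    refine h.trans ?_
    have hint : Integrable |μ[f | 𝒢 N]| μ := integrable_condExp.abs
    calc ENNReal.ofReal (∫ ω in _, |μ[f | 𝒢 N]| ω ∂μ)
        ≤ ENNReal.ofReal (∫ ω, |μ[f | 𝒢 N]| ω ∂μ) :=
          ENNReal.ofReal_le_ofReal
            (setIntegral_le_integral hint (Eventually.of_forall fun ω => abs_nonneg _))
      _ = eLpNorm (μ[f | 𝒢 N]) 1 μ := by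
          rw [eLpNorm_one_eq_lintegral_enorm,
            ofReal_integral_eq_lintegral_ofReal hint (Eventually.of_forall fun ω => abs_nonneg _)]
          simp [Real.enorm_eq_ofReal_abs]
      _ ≤ eLpNorm f 1 μ := eLpNorm_condExp_le_eLpNorm f le_rfl
  have hU : {ω | ∃ n, (ε : ℝ) ≤ |(μ[f | m n]) ω|} =
      ⋃ N, {ω | ∃ n ≤ N, (ε : ℝ) ≤ |(μ[f | m n]) ω|} := by
    ext ω
    simp only [Set.mem_ofPred_eq, Set.mem_iUnion]
    exact ⟨fun ⟨n, h⟩ => ⟨n, n, le_rfl, h⟩, fun ⟨_, n, _, h⟩ => ⟨n, h⟩⟩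
  have hmono : Monotone fun N => {ω | ∃ n ≤ N, (ε : ℝ) ≤ |(μ[f | m n]) ω|} :=
    fun a b hab ω ⟨n, hn, h⟩ => ⟨n, hn.trans hab, h⟩
  rw [hU, hmono.measure_iUnion, ENNReal.mul_iSup]
  exact iSup_le key

/-- The witness for the intersection is the upper limit of measurable versions for the single `m n`;
being unchanged by dropping initial terms, it is measurable for every one of them. -/
theorem aestronglyMeasurable_iInf_of_antitone {Ω : Type*} {m0 : MeasurableSpace Ω}
    {μ : Measure Ω} {m : ℕ → MeasurableSpace Ω} (hm : Antitone m)
    {f : Ω → ℝ} (hf : ∀ n, AEStronglyMeasurable[m n] f μ) :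
    AEStronglyMeasurable[⨅ n, m n] f μ := by
  choose g hg hfg using hf
  refine ⟨fun ω => limsup (fun n => g n ω) atTop, ?_, ?_⟩
  · refine Measurable.stronglyMeasurable ?_
    rw [measurable_iff_comap_le, le_iInf_iff]
    intro k
    rw [← measurable_iff_comap_le]
    have : (fun ω => limsup (fun n => g n ω) atTop) =
        fun ω => limsup (fun n => g (n + k) ω) atTop := by
      funext ω
      exact (limsup_nat_add (fun n => g n ω) k).symm
    rw [this]
    exact Measurable.limsup fun n => ((hg (n + k)).mono (hm (by omega))).measurable
  · filter_upwards [ae_all_iff.2 hfg] with ω h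
    simp [← h]

/-- In `L²` the conditional expectations are orthogonal projections onto decreasing closed subspaces.
They converge because the projections onto the increasing orthogonal complements do. -/
theorem tendsto_eLpNorm_two_condExp_of_antitone {Ω : Type*} {m0 : MeasurableSpace Ω}
    {μ : Measure Ω} [IsFiniteMeasure μ] {m : ℕ → MeasurableSpace Ω} (hle : ∀ n, m n ≤ m0)
    (hm : Antitone m) {f : Ω → ℝ} (hf : MemLp f 2 μ) :
    Tendsto (fun n => eLpNorm (μ[f | m n] - μ[f | ⨅ n, m n]) 2 μ) atTop (𝓝 0) := by
  have hle' : (⨅ n, m n) ≤ m0 := (iInf_le m 0).trans (hle 0)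
  let V : ℕ → Submodule ℝ (Lp ℝ 2 μ) := fun n => lpMeas ℝ ℝ (m n) 2 μ
  have : ∀ n, Fact (m n ≤ m0) := fun n => ⟨hle n⟩
  have hcomp : ∀ n, CompleteSpace (V n) := fun n => inferInstance
  have hV : Antitone V := fun a b hab x hx => by
    have hx' := mem_lpMeas_iff_aestronglyMeasurable.1 hx
    exact mem_lpMeas_iff_aestronglyMeasurable.2 (hx'.mono (hm hab))
  have hW : Monotone fun n => (V n)ᗮ := fun a b hab => Submodule.orthogonal_le (hV hab)
  let x : Lp ℝ 2 μ := hf.toLp f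
  obtain ⟨z, hz⟩ : ∃ z, Tendsto (fun n => ((V n)ᗮ).starProjection x) atTop (𝓝 z) :=
    ⟨_, Submodule.starProjection_tendsto_closure_iSup _ hW x⟩
  have hy : Tendsto (fun n => (V n).starProjection x) atTop (𝓝 (x - z)) := by
    have := hz.const_sub x
    refine this.congr fun n => ?_
    rw [Submodule.starProjection_orthogonal]; simp
  set y := x - z with hydef
  have hymem : ∀ n, y ∈ V n := by
    intro n
    have hc : IsClosed (V n : Set (Lp ℝ 2 μ)) :=
      (completeSpace_coe_iff_isComplete.1 (hcomp n)).isClosed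
    refine hc.mem_of_tendsto hy ?_
    filter_upwards [eventually_ge_atTop n] with k hk
    exact hV hk (Submodule.starProjection_apply_mem _ _)
  have hyInf : AEStronglyMeasurable[⨅ n, m n] y μ :=
    aestronglyMeasurable_iInf_of_antitone hm
      fun n => mem_lpMeas_iff_aestronglyMeasurable.1 (hymem n)
  have hcond : ∀ n, (((V n).starProjection x : Lp ℝ 2 μ) : Ω → ℝ) =ᵐ[μ] μ[f | m n] := fun n =>
    hf.condExpL2_ae_eq_condExp (𝕜 := ℝ) (hle n)
  have hlim : Tendsto (fun n => eLpNorm (μ[f | m n] - ⇑y) 2 μ) atTop (𝓝 0) := by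
    have h := (Lp.tendsto_Lp_iff_tendsto_eLpNorm' _ _).1 hy
    refine h.congr fun n => eLpNorm_congr_ae ?_
    filter_upwards [hcond n] with ω h
    simp [h]
  have hyint : Integrable ⇑y μ := (Lp.memLp y).integrable (by norm_num)
  -- By the tower property, conditioning `E[f | m n] - y` on `⨅ n, m n` gives `E[f | ⨅ n, m n] - y`
  -- for every `n`, and conditioning contracts the norm.
  have hfy : μ[f | ⨅ n, m n] =ᵐ[μ] ⇑y := by
    have hb : ∀ n, eLpNorm (μ[f | ⨅ n, m n] - ⇑y) 2 μ ≤ eLpNorm (μ[f | m n] - ⇑y) 2 μ := by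
      intro n
      have h1 : μ[f | ⨅ n, m n] - ⇑y =ᵐ[μ] μ[μ[f | m n] - ⇑y | ⨅ n, m n] := by
        have h2 := condExp_sub (μ := μ) (integrable_condExp (f := f) (m := m n)) hyint (⨅ n, m n)
        have h3 := condExp_condExp_of_le (f := f) (μ := μ) (iInf_le m n) (hle n)
        have h4 := condExp_of_aestronglyMeasurable' hle' hyInf hyint
        filter_upwards [h2, h3, h4] with ω h2 h3 h4
        simp [h2, h3, h4]
      rw [eLpNorm_congr_ae h1]
      exact eLpNorm_condExp_le_eLpNorm _ (by norm_num)
    have h0 : eLpNorm (μ[f | ⨅ n, m n] - ⇑y) 2 μ = 0 :=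
      le_antisymm (ge_of_tendsto' hlim hb) (zero_le)
    rw [eLpNorm_eq_zero_iff (integrable_condExp.aestronglyMeasurable.sub
      hyint.aestronglyMeasurable) (by norm_num)] at h0
    filter_upwards [h0] with ω h
    simpa [sub_eq_zero] using h
  refine hlim.congr fun n => eLpNorm_congr_ae ?_
  filter_upwards [hfy] with ω h
  simp [h]

theorem tendsto_eLpNorm_one_condExp_of_antitone {Ω : Type*} {m0 : MeasurableSpace Ω}
    {μ : Measure Ω} [IsFiniteMeasure μ] {m : ℕ → MeasurableSpace Ω} (hle : ∀ n, m n ≤ m0)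
    (hm : Antitone m) {f : Ω → ℝ} (hf : Integrable f μ) :
    Tendsto (fun n => eLpNorm (μ[f | m n] - μ[f | ⨅ n, m n]) 1 μ) atTop (𝓝 0) := by
  rw [ENNReal.tendsto_atTop_zero]
  intro ε hε
  have hε3 : ε / 3 ≠ 0 := (ENNReal.div_pos hε.ne' (by norm_num)).ne'
  obtain ⟨g, hfg, hg⟩ := (memLp_one_iff_integrable.2 hf).exists_simpleFunc_eLpNorm_sub_lt
    ENNReal.one_ne_top hε3
  have hg2 : MemLp g 2 μ := g.memLp_of_isFiniteMeasure 2 μ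
  have hgi : Integrable g μ := hg2.integrable (by norm_num)
  have hlim1 : Tendsto (fun n => eLpNorm (μ[g | m n] - μ[g | ⨅ n, m n]) 1 μ) atTop (𝓝 0) := by
    have h2 := tendsto_eLpNorm_two_condExp_of_antitone hle hm hg2
    have h3 := ENNReal.Tendsto.mul_const (b := μ Set.univ ^ (1 / (1 : ℝ≥0∞).toReal - 1 /
      (2 : ℝ≥0∞).toReal)) h2 (Or.inr (ENNReal.rpow_ne_top_of_nonneg (by norm_num)
        (measure_ne_top _ _)))
    rw [zero_mul] at h3
    refine tendsto_of_tendsto_of_tendsto_of_le_of_le tendsto_const_nhds h3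
      (fun _ => zero_le) fun n => ?_
    exact eLpNorm_le_eLpNorm_mul_rpow_measure_univ (by norm_num)
      (integrable_condExp.aestronglyMeasurable.sub integrable_condExp.aestronglyMeasurable)
  obtain ⟨N, hN⟩ := (ENNReal.tendsto_atTop_zero.1 hlim1) (ε / 3) (pos_iff_ne_zero.2 hε3)
  refine ⟨N, fun n hn => ?_⟩
  have hsm : ∀ m' : MeasurableSpace Ω, ∀ h : Ω → ℝ, AEStronglyMeasurable[m0] (μ[h | m']) μ :=
    fun m' h => (integrable_condExp (m := m') (f := h)).aestronglyMeasurable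
  have hdec : μ[f | m n] - μ[f | ⨅ n, m n] =ᵐ[μ]
      (μ[f - ⇑g | m n] + (μ[g | m n] - μ[g | ⨅ n, m n])) - μ[f - ⇑g | ⨅ n, m n] := by
    filter_upwards [condExp_sub (μ := μ) hf hgi (m n), condExp_sub (μ := μ) hf hgi (⨅ n, m n)]
      with ω h1 h2
    simp only [Pi.sub_apply, Pi.add_apply, h1, h2]
    ring
  rw [eLpNorm_congr_ae hdec]
  calc _ ≤ eLpNorm (μ[f - ⇑g | m n] + (μ[g | m n] - μ[g | ⨅ n, m n])) 1 μ
          + eLpNorm (μ[f - ⇑g | ⨅ n, m n]) 1 μ :=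
        eLpNorm_sub_le ((hsm _ _).add ((hsm _ _).sub (hsm _ _))) (hsm _ _) le_rfl
    _ ≤ (eLpNorm (μ[f - ⇑g | m n]) 1 μ + eLpNorm (μ[g | m n] - μ[g | ⨅ n, m n]) 1 μ)
          + eLpNorm (μ[f - ⇑g | ⨅ n, m n]) 1 μ := by
        gcongr
        exact eLpNorm_add_le (hsm _ _) ((hsm _ _).sub (hsm _ _)) le_rfl
    _ ≤ (ε / 3 + ε / 3) + ε / 3 := by
        gcongr
        · exact (eLpNorm_condExp_le_eLpNorm _ le_rfl).trans hfg.le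
        · exact hN n hn
        · exact (eLpNorm_condExp_le_eLpNorm _ le_rfl).trans hfg.le
    _ = ε := ENNReal.add_thirds ε

/-- **Lévy's downward theorem**. Past the index `k` the differences `E[f | m n] - E[f | ⨅ n, m n]` are
the conditional expectations of the difference `r k` at index `k`, so the maximal inequality bounds
them all by the `L¹` norm of `r k`, which tends to zero. -/
theorem tendsto_ae_condExp_of_antitone {Ω : Type*} {m0 : MeasurableSpace Ω}
    {μ : Measure Ω} [IsFiniteMeasure μ] {m : ℕ → MeasurableSpace Ω} (hle : ∀ n, m n ≤ m0)
    (hm : Antitone m) {f : Ω → ℝ} (hf : Integrable f μ) :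
    ∀ᵐ ω ∂μ, Tendsto (fun n => (μ[f | m n]) ω) atTop (𝓝 ((μ[f | ⨅ n, m n]) ω)) := by
  have hle' : (⨅ n, m n) ≤ m0 := (iInf_le m 0).trans (hle 0)
  let r : ℕ → Ω → ℝ := fun k => μ[f | m k] - μ[f | ⨅ n, m n]
  have hr0 := tendsto_eLpNorm_one_condExp_of_antitone hle hm hf
  have htower : ∀ᵐ ω ∂μ, ∀ k j, (μ[f | m (j + k)]) ω - (μ[f | ⨅ n, m n]) ω
      = (μ[r k | m (j + k)]) ω := by
    refine ae_all_iff.2 fun k => ae_all_iff.2 fun j => ?_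
    have h1 := condExp_sub (μ := μ) (integrable_condExp (f := f) (m := m k))
      (integrable_condExp (f := f) (m := ⨅ n, m n)) (m (j + k))
    have h2 := condExp_condExp_of_le (f := f) (μ := μ) (hm (Nat.le_add_left k j)) (hle k)
    have h3 : μ[μ[f | ⨅ n, m n] | m (j + k)] = μ[f | ⨅ n, m n] :=
      condExp_of_stronglyMeasurable (hle _)
        (stronglyMeasurable_condExp.mono (iInf_le m _)) integrable_condExp
    filter_upwards [h1, h2] with ω h1 h2
    rw [h1, Pi.sub_apply, h2, h3]
  have hbad : ∀ i : ℕ, ∀ᵐ ω ∂μ, ∃ k, ∀ j, |(μ[r k | m (j + k)]) ω| < ((i : ℝ) + 1)⁻¹ := by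
    intro i
    let ε : NNReal := ((i : NNReal) + 1)⁻¹
    have hε : (ε : ℝ≥0∞) ≠ 0 := by simp [ε]
    have hεr : (ε : ℝ) = ((i : ℝ) + 1)⁻¹ := by simp [ε]
    rw [ae_iff]
    have hb : ∀ k, ε * μ {ω | ¬ ∃ k, ∀ j, |(μ[r k | m (j + k)]) ω| < ((i : ℝ) + 1)⁻¹} ≤
        eLpNorm (r k) 1 μ := by
      intro k
      refine le_trans ?_ (maximal_ineq_condExp_of_antitone (m := fun j => m (j + k))
        (fun j => hle _) (fun a b hab => hm (by omega)) (r k) ε)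
      gcongr
      intro h
      push Not at h
      simpa [hεr] using h k
    have h0 := le_antisymm (ge_of_tendsto' hr0 hb) zero_le
    exact (mul_eq_zero.1 h0).resolve_left hε
  filter_upwards [htower, ae_all_iff.2 hbad] with ω ht hb
  rw [Metric.tendsto_atTop]
  intro ε hε
  obtain ⟨i, hi⟩ := exists_nat_one_div_lt hε
  obtain ⟨k, hk⟩ := hb i
  refine ⟨k, fun n hn => ?_⟩
  have h := hk (n - k)
  rw [← ht k (n - k), Nat.sub_add_cancel hn] at h
  rw [Real.dist_eq]
  rw [one_div] at hi
  exact h.trans hi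

/-! ### Counting measures of enumerated relations and mass transport -/

/-- An enumeration, without repetition, of the classes of a relation `R` by countably many partially
defined non-singular maps: `R x y` holds iff `y = map i x` for some `i` with `x ∈ dom i`, and then
`i` is unique. The maps themselves are defined everywhere; only their restrictions to `dom i`
enumerate the classes. -/
structure ClassEnumeration {B : Type*} [MeasurableSpace B] (μ : Measure B) (R : B → B → Prop)
    (ι : Type*) where
  map : ι → B → B
  dom : ι → Set B
  measurableSet_dom : ∀ i, MeasurableSet (dom i)
  quasi : ∀ i, Measure.QuasiMeasurePreserving (map i) μ μ
  rel_iff : ∀ x y, R x y ↔ ∃ i, x ∈ dom i ∧ map i x = y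
  inj : ∀ x i j, x ∈ dom i → x ∈ dom j → map i x = map j x → i = j

namespace ClassEnumeration

variable {B : Type*} [MeasurableSpace B] {μ : Measure B} {R : B → B → Prop} {ι : Type*}

/-- Sums over a class are sums over the index set of the enumeration. -/
theorem tsum_class (e : ClassEnumeration μ R ι) (f : B → ℝ≥0∞) (x : B) :
    ∑' y : {y // R x y}, f y = ∑' i, (e.dom i).indicator (fun x => f (e.map i x)) x := by
  have hbij : Function.Bijective
      (fun i : {i // x ∈ e.dom i} => (⟨e.map i x, (e.rel_iff _ _).2 ⟨i, i.2, rfl⟩⟩ :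
        {y // R x y})) := by
    constructor
    · intro i j h
      exact Subtype.ext (e.inj x i j i.2 j.2 (congrArg Subtype.val h))
    · rintro ⟨y, hy⟩
      obtain ⟨i, hi, h⟩ := (e.rel_iff _ _).1 hy
      exact ⟨⟨i, hi⟩, Subtype.ext h⟩
  rw [← (Equiv.ofBijective _ hbij).tsum_eq]
  refine (tsum_subtype {i | x ∈ e.dom i} fun i => f (e.map i x)).trans ?_
  rfl

variable [Countable ι]

theorem measurable_tsum_class (e : ClassEnumeration μ R ι) {f : B × B → ℝ≥0∞}
    (hf : Measurable f) : Measurable fun x => ∑' y : {y // R x y}, f (x, y) := by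
  have : (fun x => ∑' y : {y // R x y}, f (x, y)) =
      fun x => ∑' i, (e.dom i).indicator (fun z => f (z, e.map i z)) x := by
    funext x
    rw [e.tsum_class (fun y => f (x, y)) x]
    rfl
  rw [this]
  exact Measurable.tsum fun i =>
    (hf.comp (measurable_id.prodMk (e.quasi i).measurable)).indicator (e.measurableSet_dom i)

/-- The measurability without which the measure `leftCountingMeasure`, defined by `Measure.bind`, would
be a junk value. -/
theorem measurable_counting (e : ClassEnumeration μ R ι) :
    Measurable fun x => Measure.sum fun y : {y : B // R x y} => Measure.dirac (x, y.1) := by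
  refine Measure.measurable_of_measurable_coe _ fun s hs => ?_
  simp only [Measure.sum_apply _ hs, Measure.dirac_apply' _ hs]
  exact e.measurable_tsum_class (f := s.indicator 1) (measurable_one.indicator hs)

theorem lintegral_leftCountingMeasure (e : ClassEnumeration μ R ι) {f : B × B → ℝ≥0∞}
    (hf : Measurable f) :
    ∫⁻ p, f p ∂(leftCountingMeasure μ R) = ∫⁻ x, ∑' y : {y // R x y}, f (x, y) ∂μ := by
  rw [leftCountingMeasure, Measure.lintegral_bind e.measurable_counting.aemeasurable
    hf.aemeasurable]
  refine lintegral_congr fun x => ?_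
  rw [lintegral_sum_measure]
  exact tsum_congr fun y => lintegral_dirac' _ hf

theorem lintegral_rightCountingMeasure (e : ClassEnumeration μ R ι) {f : B × B → ℝ≥0∞}
    (hf : Measurable f) :
    ∫⁻ p, f p ∂(rightCountingMeasure μ R) = ∫⁻ x, ∑' y : {y // R x y}, f (y, x) ∂μ := by
  rw [rightCountingMeasure, lintegral_map hf measurable_swap,
    e.lintegral_leftCountingMeasure (f := fun p => f p.swap) (hf.comp measurable_swap)]
  rfl

/-- The saturation of a null set is null. -/
theorem ae_forall_rel (e : ClassEnumeration μ R ι) {P : B → Prop} (hP : ∀ᵐ x ∂μ, P x) :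
    ∀ᵐ x ∂μ, ∀ y, R x y → P y := by
  filter_upwards [ae_all_iff.2 fun i => (e.quasi i).ae hP] with x hx y hy
  obtain ⟨i, -, rfl⟩ := (e.rel_iff _ _).1 hy
  exact hx i

theorem leftCountingMeasure_eq_zero_iff (e : ClassEnumeration μ R ι) {s : Set (B × B)}
    (hs : MeasurableSet s) :
    leftCountingMeasure μ R s = 0 ↔ ∀ᵐ x ∂μ, ∀ y, R x y → (x, y) ∉ s := by
  have hf : Measurable (s.indicator (1 : B × B → ℝ≥0∞)) := measurable_one.indicator hs
  rw [← lintegral_indicator_one hs, e.lintegral_leftCountingMeasure hf,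
    lintegral_eq_zero_iff (e.measurable_tsum_class hf)]
  refine eventually_congr (Eventually.of_forall fun x => ?_)
  simp

theorem absolutelyContinuous (e : ClassEnumeration μ R ι) (hsymm : ∀ x y, R x y → R y x) :
    leftCountingMeasure μ R ≪ rightCountingMeasure μ R := by
  refine Measure.AbsolutelyContinuous.mk fun s hs h => ?_
  rw [rightCountingMeasure, Measure.map_apply measurable_swap hs,
    e.leftCountingMeasure_eq_zero_iff (measurable_swap hs)] at h
  rw [e.leftCountingMeasure_eq_zero_iff hs]
  filter_upwards [e.ae_forall_rel h] with x hx y hy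
  exact hx y hy x (hsymm x y hy)

/-- The graphs of the maps of the enumeration, cut down to sets of finite measure, cover the relation. -/
theorem sigmaFinite_leftCountingMeasure [MeasurableEq B] [SigmaFinite μ]
    (e : ClassEnumeration μ R ι) : SigmaFinite (leftCountingMeasure μ R) := by
  let Γ : ι → Set (B × B) := fun i => {p | p.1 ∈ e.dom i ∧ e.map i p.1 = p.2}
  have hΓ : ∀ i, MeasurableSet (Γ i) := fun i =>
    (measurable_fst (e.measurableSet_dom i)).inter
      (measurableSet_eq_fun ((e.quasi i).measurable.comp measurable_fst) measurable_snd)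
  let A : ι × ℕ → Set (B × B) := fun q => Γ q.1 ∩ Prod.fst ⁻¹' spanningSets μ q.2
  have hA : ∀ q, MeasurableSet (A q) := fun q =>
    (hΓ _).inter (measurable_fst (measurableSet_spanningSets μ _))
  refine Measure.sigmaFinite_of_countable (S := insert (⋃ i, Γ i)ᶜ (Set.range A))
    ((Set.countable_range A).insert _) ?_ ?_
  · rintro s (rfl | ⟨⟨i, k⟩, rfl⟩)
    · have : leftCountingMeasure μ R (⋃ i, Γ i)ᶜ = 0 := by
        rw [e.leftCountingMeasure_eq_zero_iff (MeasurableSet.iUnion hΓ).compl]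
        refine Eventually.of_forall fun x y hy h => h ?_
        obtain ⟨i, hi⟩ := (e.rel_iff _ _).1 hy
        exact Set.mem_iUnion.2 ⟨i, hi⟩
      rw [this]
      exact ENNReal.zero_lt_top
    · have hf : Measurable ((A (i, k)).indicator (1 : B × B → ℝ≥0∞)) :=
        measurable_one.indicator (hA _)
      rw [← lintegral_indicator_one (hA _), e.lintegral_leftCountingMeasure hf]
      refine lt_of_le_of_lt ?_ (measure_spanningSets_lt_top μ k)
      rw [← lintegral_indicator_one (measurableSet_spanningSets μ k)]
      refine lintegral_mono fun x => ?_
      rw [e.tsum_class (fun y => (A (i, k)).indicator 1 (x, y)) x, tsum_eq_single i]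
      · by_cases hx : x ∈ spanningSets μ k
        · rw [Set.indicator_of_mem hx]
          exact (Set.indicator_le_self' (fun _ _ => zero_le) _).trans
            (Set.indicator_le_self' (fun _ _ => zero_le) _)
        · have : (x, e.map i x) ∉ A (i, k) := fun h => hx h.2
          simp [Set.indicator, this]
      · intro j hj
        by_cases hx : x ∈ e.dom j
        · have : (x, e.map j x) ∉ A (i, k) := fun h => hj (e.inj x j i hx h.1.1 h.1.2.symm)
          simp [Set.indicator, this]
        · simp [hx]
  · rw [Set.sUnion_insert, Set.eq_univ_iff_forall]
    intro p
    by_cases hp : p ∈ ⋃ i, Γ i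
    · obtain ⟨i, hi⟩ := Set.mem_iUnion.1 hp
      have hk : p.1 ∈ ⋃ k, spanningSets μ k := by rw [iUnion_spanningSets]; trivial
      obtain ⟨k, hk⟩ := Set.mem_iUnion.1 hk
      exact Or.inr ⟨A (i, k), ⟨(i, k), rfl⟩, hi, hk⟩
    · exact Or.inl hp

/-- The mass transport formula: mass sent from `x` to `y` may be counted at its destination, at the
price of the Radon-Nikodym cocycle. -/
theorem lintegral_transport [MeasurableEq B] [SigmaFinite μ] (e : ClassEnumeration μ R ι)
    (hsymm : ∀ x y, R x y → R y x) {f : B × B → ℝ≥0∞} (hf : Measurable f) :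
    ∫⁻ x, ∑' y : {y // R x y}, f (x, y) ∂μ =
      ∫⁻ x, ∑' y : {y // R x y}, ENNReal.ofReal (rnCocycle μ R y x) * f (y, x) ∂μ := by
  have hM := e.sigmaFinite_leftCountingMeasure
  have hM' : SigmaFinite (rightCountingMeasure μ R) :=
    MeasurableEquiv.prodComm.sigmaFinite_map
  have hrn := Measure.measurable_rnDeriv (leftCountingMeasure μ R) (rightCountingMeasure μ R)
  rw [← e.lintegral_leftCountingMeasure hf,
    ← lintegral_rnDeriv_mul (e.absolutelyContinuous hsymm) hf.aemeasurable,
    ← e.lintegral_rightCountingMeasure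
      (f := fun p => ENNReal.ofReal (rnCocycle μ R p.1 p.2) * f p)
      (hrn.ennreal_toReal.ennreal_ofReal.mul hf)]
  refine lintegral_congr_ae ?_
  filter_upwards [Measure.rnDeriv_lt_top (leftCountingMeasure μ R) (rightCountingMeasure μ R)]
    with p hp
  rw [rnCocycle, ENNReal.ofReal_toReal hp.ne]

end ClassEnumeration

theorem tsum_class_indicator {B : Type*} {R : B → B → Prop} {F : B → Finset B}
    (hFR : ∀ x, ∀ y ∈ F x, R x y) (f : B → ℝ≥0∞) (x : B) :
    ∑' y : {y // R x y}, (F x : Set B).indicator f y = ∑ y ∈ F x, f y := by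
  refine (tsum_subtype {y | R x y} ((F x : Set B).indicator f)).trans ?_
  have hsub : (F x : Set B) ⊆ {y | R x y} := fun y hy => hFR x y hy
  rw [Set.indicator_indicator, Set.inter_eq_right.2 hsub]
  exact (sum_eq_tsum_indicator f (F x)).symm

/-! ### Ratios over finite subrelations as conditional expectations -/

/-- The finite sets `F x` are the classes of a measurable equivalence relation contained in `R`. -/
structure IsFiniteSubrelation {B : Type*} [MeasurableSpace B] (R : B → B → Prop)
    (F : B → Finset B) : Prop where
  rel : ∀ x, ∀ y ∈ F x, R x y
  measurableSet : MeasurableSet {p : B × B | p.2 ∈ F p.1}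
  self_mem : ∀ x, x ∈ F x
  eq_of_mem : ∀ x, ∀ y ∈ F x, F y = F x

theorem invariantSigma_le {B : Type*} [m : MeasurableSpace B] (R : B → B → Prop) :
    invariantSigma R ≤ m := fun _ h => h.1

/-- A function measurable for the `σ`-algebra of invariant sets is constant on classes everywhere, not
only almost everywhere. -/
theorem Measurable.eq_of_rel {B : Type*} [MeasurableSpace B] {R : B → B → Prop}
    {β : Type*} [MeasurableSpace β] [MeasurableSingletonClass β] {f : B → β}
    (hf : Measurable[invariantSigma R] f) {x y : B} (h : R x y) : f x = f y :=
  (((hf (measurableSet_singleton (f x))).2 x y h).1 rfl).symm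

namespace IsFiniteSubrelation

variable {B : Type*} [MeasurableSpace B] {R : B → B → Prop} {F : B → Finset B}

theorem mem_comm (hF : IsFiniteSubrelation R F) (x y : B) : y ∈ F x ↔ x ∈ F y :=
  ⟨fun h => by rw [hF.eq_of_mem x y h]; exact hF.self_mem x,
    fun h => by rw [hF.eq_of_mem y x h]; exact hF.self_mem y⟩

variable {μ : Measure B} {ι : Type*} [Countable ι]

theorem measurable_sum (hF : IsFiniteSubrelation R F) (e : ClassEnumeration μ R ι)
    {f : B × B → ℝ≥0∞} (hf : Measurable f) : Measurable fun x => ∑ y ∈ F x, f (x, y) := by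
  have h := e.measurable_tsum_class (hf.indicator hF.measurableSet)
  convert h using 2 with x
  rw [← tsum_class_indicator hF.rel]
  rfl

theorem measurable_sum_invariant (hF : IsFiniteSubrelation R F) (e : ClassEnumeration μ R ι)
    {g : B → ℝ≥0∞} (hg : Measurable g) :
    Measurable[invariantSigma fun x y => y ∈ F x] fun x => ∑ y ∈ F x, g y := by
  intro t ht
  refine ⟨hF.measurable_sum e (f := fun p => g p.2) (hg.comp measurable_snd) ht, ?_⟩
  intro x y hy
  simp only [Set.mem_preimage, hF.eq_of_mem x y hy]

theorem measurable_weighted_sum (hF : IsFiniteSubrelation R F) (e : ClassEnumeration μ R ι)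
    {w : B → ℝ≥0∞} (hw : Measurable w) :
    Measurable fun x => ∑ y ∈ F x, w y * ENNReal.ofReal (rnCocycle μ R y x) :=
  hF.measurable_sum e
    (f := fun p => w p.2 * ENNReal.ofReal (rnCocycle μ R p.2 p.1))
    ((hw.comp measurable_snd).mul
      ((Measure.measurable_rnDeriv (leftCountingMeasure μ R)
        (rightCountingMeasure μ R)).comp measurable_swap).ennreal_toReal.ennreal_ofReal)

theorem lintegral_transport [MeasurableEq B] [SigmaFinite μ] (hF : IsFiniteSubrelation R F)
    (e : ClassEnumeration μ R ι) (hsymm : ∀ x y, R x y → R y x)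
    {w g : B → ℝ≥0∞} (hw : Measurable w) (hg : Measurable g) :
    ∫⁻ x, w x * ∑ y ∈ F x, g y ∂μ =
      ∫⁻ x, g x * ∑ y ∈ F x, w y * ENNReal.ofReal (rnCocycle μ R y x) ∂μ := by
  have h := e.lintegral_transport hsymm
    (f := {p : B × B | p.2 ∈ F p.1}.indicator fun p => w p.1 * g p.2)
    (((hw.comp measurable_fst).mul (hg.comp measurable_snd)).indicator hF.measurableSet)
  convert h using 3 with x x
  · rw [Finset.mul_sum, ← tsum_class_indicator hF.rel]
    rfl
  · rw [Finset.mul_sum, ← tsum_class_indicator hF.rel]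
    refine tsum_congr fun y => ?_
    by_cases hy : (y : B) ∈ F x
    · rw [Set.indicator_of_mem (Finset.mem_coe.2 hy),
        Set.indicator_of_mem (by exact (hF.mem_comm _ _).1 hy)]
      ring
    · rw [Set.indicator_of_notMem (by simpa using hy),
        Set.indicator_of_notMem (by exact fun h => hy ((hF.mem_comm _ _).2 h)), mul_zero]

/-- Mass sent from `x` to the zero set of the sum arrives with total weight zero, yet each `x` sends
some to itself. -/
theorem ae_weighted_sum_ne_zero [MeasurableEq B] [SigmaFinite μ] (hF : IsFiniteSubrelation R F)
    (e : ClassEnumeration μ R ι) (hsymm : ∀ x y, R x y → R y x)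
    {w : B → ℝ≥0∞} (hw : Measurable w) (hpos : ∀ x, w x ≠ 0) :
    ∀ᵐ x ∂μ, ∑ y ∈ F x, w y * ENNReal.ofReal (rnCocycle μ R y x) ≠ 0 := by
  set S := fun x => ∑ y ∈ F x, w y * ENNReal.ofReal (rnCocycle μ R y x) with hS
  have hSm : Measurable S := hF.measurable_weighted_sum e hw
  have hs : MeasurableSet (S ⁻¹' {0}) := hSm (measurableSet_singleton 0)
  have hg : Measurable ((S ⁻¹' {0}).indicator (1 : B → ℝ≥0∞)) := measurable_one.indicator hs
  have h := hF.lintegral_transport e hsymm hw hg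
  have h0 : ∫⁻ x, (S ⁻¹' {0}).indicator (1 : B → ℝ≥0∞) x * S x ∂μ = 0 := by
    rw [lintegral_eq_zero_iff (by exact hg.mul hSm)]
    refine Eventually.of_forall fun x => ?_
    by_cases hx : S x = 0 <;> simp [Set.indicator, hx]
  rw [h0, lintegral_eq_zero_iff
    (by exact hw.mul ((hF.measurable_sum_invariant e hg).mono (invariantSigma_le _) le_rfl))] at h
  filter_upwards [h] with x hx hx0
  have h1 := (mul_eq_zero.1 hx).resolve_left (hpos x)
  have h2 := (Finset.sum_eq_zero_iff.1 h1) x (hF.self_mem x)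
  rw [Set.indicator_of_mem (by exact hx0)] at h2
  exact one_ne_zero h2

/-- If `w₁` and `c * w₂` have the same integral over all invariant sets, then their weighted sums
over classes agree, and since `c` is invariant the latter is `c` times that of `w₂`. The two sums
are compared by integrating over an arbitrary measurable set `s`: by mass transport this amounts to integrating `w₁` and `c * w₂` against the invariant function `x ↦ #(F x ∩ s)`. This
needs no cocycle identity for `rnCocycle`. -/
theorem ae_weighted_sum_eq [MeasurableEq B] [SigmaFinite μ] (hF : IsFiniteSubrelation R F)
    (e : ClassEnumeration μ R ι) (hsymm : ∀ x y, R x y → R y x)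
    {w₁ w₂ c : B → ℝ≥0∞} (hw₁ : Measurable w₁) (hw₂ : Measurable w₂)
    (hc : Measurable[invariantSigma fun x y => y ∈ F x] c)
    (h : ∀ s, MeasurableSet[invariantSigma fun x y => y ∈ F x] s →
      ∫⁻ x in s, w₁ x ∂μ = ∫⁻ x in s, c x * w₂ x ∂μ) :
    ∀ᵐ x ∂μ, ∑ y ∈ F x, w₁ y * ENNReal.ofReal (rnCocycle μ R y x) =
      c x * ∑ y ∈ F x, w₂ y * ENNReal.ofReal (rnCocycle μ R y x) := by
  have hle := invariantSigma_le (B := B) fun x y => y ∈ F x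
  have hc' : Measurable c := hc.mono hle le_rfl
  have hcw : Measurable fun x => c x * w₂ x := hc'.mul hw₂
  have htest : ∀ G : B → ℝ≥0∞, Measurable[invariantSigma fun x y => y ∈ F x] G →
      ∫⁻ x, w₁ x * G x ∂μ = ∫⁻ x, c x * w₂ x * G x ∂μ := by
    intro G hG
    have htrim : (μ.withDensity w₁).trim hle = (μ.withDensity fun x => c x * w₂ x).trim hle := by
      refine @Measure.ext _ (invariantSigma _) _ _ fun s hs => ?_
      rw [trim_measurableSet_eq hle hs, trim_measurableSet_eq hle hs,
        withDensity_apply _ (hle _ hs), withDensity_apply _ (hle _ hs), h s hs]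
    have := congrArg (fun ρ => @lintegral B (invariantSigma _) ρ G) htrim
    simp only [lintegral_trim hle hG] at this
    rwa [lintegral_withDensity_eq_lintegral_mul _ hw₁ (hG.mono hle le_rfl),
      lintegral_withDensity_eq_lintegral_mul _ hcw (hG.mono hle le_rfl)] at this
  have hpull : ∀ x, c x * ∑ y ∈ F x, w₂ y * ENNReal.ofReal (rnCocycle μ R y x) =
      ∑ y ∈ F x, c y * w₂ y * ENNReal.ofReal (rnCocycle μ R y x) := by
    intro x
    rw [Finset.mul_sum]
    refine Finset.sum_congr rfl fun y hy => ?_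
    rw [hc.eq_of_rel hy, mul_assoc]
  simp only [hpull]
  refine ae_eq_of_forall_setLIntegral_eq_of_sigmaFinite (hF.measurable_weighted_sum e hw₁)
    (hF.measurable_weighted_sum e hcw) fun s hs _ => ?_
  have hg : Measurable (s.indicator (1 : B → ℝ≥0∞)) := measurable_one.indicator hs
  have hind : ∀ f : B → ℝ≥0∞, ∫⁻ x in s, f x ∂μ = ∫⁻ x, s.indicator 1 x * f x ∂μ := by
    intro f
    rw [← lintegral_indicator hs]
    refine lintegral_congr fun x => ?_
    by_cases hx : x ∈ s <;> simp [hx]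
  rw [hind, hind, ← hF.lintegral_transport e hsymm hw₁ hg,
    ← hF.lintegral_transport e hsymm hcw hg]
  exact htest _ (hF.measurable_sum_invariant e hg)

end IsFiniteSubrelation

/-- For nonnegative `u` the real sum is the value of the extended nonnegative one; no summand is
infinite. -/
theorem relSum_eq_toReal {B : Type*} [MeasurableSpace B] (μ : Measure B) (R : B → B → Prop)
    (F : ℕ → B → Finset B) (n : ℕ) {u : B → ℝ} (hu : 0 ≤ u) (x : B) :
    relSum μ R F n u x =
      (∑ y ∈ F n x, ENNReal.ofReal (u y) * ENNReal.ofReal (rnCocycle μ R y x)).toReal := by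
  rw [relSum, ENNReal.toReal_sum
    fun y _ => ENNReal.mul_ne_top ENNReal.ofReal_ne_top ENNReal.ofReal_ne_top]
  refine Finset.sum_congr rfl fun y _ => ?_
  rw [ENNReal.toReal_mul, ENNReal.toReal_ofReal (hu y),
    ENNReal.toReal_ofReal (by exact ENNReal.toReal_nonneg)]

theorem integrable_div_withDensity {B : Type*} [MeasurableSpace B] {μ : Measure B} {u v : B → ℝ}
    (hu : Integrable u μ) (hvm : AEMeasurable v μ) (hvpos : ∀ᵐ x ∂μ, 0 < v x) :
    Integrable (fun x => u x / v x) (μ.withDensity fun x => ENNReal.ofReal (v x)) := by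
  rw [integrable_withDensity_iff_integrable_smul₀' hvm.ennreal_ofReal
    (Eventually.of_forall fun _ => ENNReal.ofReal_lt_top)]
  refine hu.congr (hvpos.mono fun x hx => ?_)
  simp only [ENNReal.toReal_ofReal hx.le, smul_eq_mul]
  rw [mul_div_cancel₀ _ hx.ne']

/-- A measurable set is invariant under a union of relations iff it is invariant under each of them. -/
theorem iInf_invariantSigma {B : Type*} [MeasurableSpace B] {R : B → B → Prop}
    {S : ℕ → B → B → Prop} (hR : ∀ x y, R x y ↔ ∃ n, S n x y) :
    ⨅ n, invariantSigma (S n) = invariantSigma R := by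
  ext s
  rw [MeasurableSpace.measurableSet_iInf]
  constructor
  · intro h
    refine ⟨(h 0).1, fun x y hxy => ?_⟩
    obtain ⟨n, hn⟩ := (hR x y).1 hxy
    exact (h n).2 x y hn
  · intro h n
    exact ⟨h.1, fun x y hxy => h.2 x y ((hR x y).2 ⟨n, hxy⟩)⟩

section Ratio

variable {B : Type*} [MeasurableSpace B] [MeasurableEq B] {μ : Measure B} [SigmaFinite μ]
  {R : B → B → Prop} {ι : Type*} [Countable ι] {F : ℕ → B → Finset B}

/-- For `u ≥ 0` the sum of `u` is the conditional expectation of `u / v` times the sum of `v`. On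
invariant sets, `u dμ = (u / v) dμ_v` and `c v dμ = c dμ_v` have the same mass by the definition of the
conditional expectation `c`. -/
theorem ae_relSum_eq_condExp_mul (e : ClassEnumeration μ R ι) (hsymm : ∀ x y, R x y → R y x)
    {n : ℕ} (hF : IsFiniteSubrelation R (F n)) {u v : B → ℝ}
    (hum : Measurable u) (hu : Integrable u μ) (hu0 : 0 ≤ u)
    (hvm : Measurable v) (hv : Integrable v μ) (hvpos : ∀ x, 0 < v x) :
    ∀ᵐ x ∂μ, relSum μ R F n u x =
      ((μ.withDensity fun x => ENNReal.ofReal (v x))[fun x => u x / v x |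
        invariantSigma fun x y => y ∈ F n x]) x * relSum μ R F n v x := by
  set κ := μ.withDensity fun x => ENNReal.ofReal (v x) with hκ
  have hle := invariantSigma_le (B := B) fun x y => y ∈ F n x
  have hκfin : IsFiniteMeasure κ := isFiniteMeasure_withDensity_ofReal hv.2
  have hint : Integrable (fun x => u x / v x) κ :=
    integrable_div_withDensity hu hvm.aemeasurable (Eventually.of_forall hvpos)
  have hac : μ ≪ κ := withDensity_absolutelyContinuous' hvm.ennreal_ofReal.aemeasurable
    (Eventually.of_forall fun x => (ENNReal.ofReal_pos.2 (hvpos x)).ne')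
  set c := κ[fun x => u x / v x | invariantSigma fun x y => y ∈ F n x] with hcdef
  have hcm : Measurable[invariantSigma fun x y => y ∈ F n x] c :=
    stronglyMeasurable_condExp.measurable
  have hc0 : 0 ≤ᵐ[κ] c :=
    condExp_nonneg (Eventually.of_forall fun x => div_nonneg (hu0 x) (hvpos x).le)
  have hset : ∀ s, MeasurableSet[invariantSigma fun x y => y ∈ F n x] s →
      ∫⁻ x in s, ENNReal.ofReal (u x) ∂μ =
        ∫⁻ x in s, ENNReal.ofReal (c x) * ENNReal.ofReal (v x) ∂μ := by
    intro s hs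
    have hs' := hle _ hs
    have h1 : ∀ f : B → ℝ, Measurable f → ∫⁻ x in s, ENNReal.ofReal (f x) ∂κ =
        ∫⁻ x in s, ENNReal.ofReal (f x) * ENNReal.ofReal (v x) ∂μ := by
      intro f hf
      rw [hκ, setLIntegral_withDensity_eq_setLIntegral_mul _ hvm.ennreal_ofReal
        hf.ennreal_ofReal hs']
      simp only [Pi.mul_apply, mul_comm]
    rw [← h1 c (hcm.mono hle le_rfl),
      ← ofReal_integral_eq_lintegral_ofReal integrable_condExp.integrableOn
        (ae_restrict_of_ae hc0), setIntegral_condExp hle hint hs,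
      ofReal_integral_eq_lintegral_ofReal hint.integrableOn
        (Eventually.of_forall fun x => div_nonneg (hu0 x) (hvpos x).le),
      h1 (fun x => u x / v x) (hum.div hvm)]
    refine lintegral_congr fun x => ?_
    rw [← ENNReal.ofReal_mul (div_nonneg (hu0 x) (hvpos x).le),
      div_mul_cancel₀ _ (hvpos x).ne']
  filter_upwards [hF.ae_weighted_sum_eq e hsymm hum.ennreal_ofReal hvm.ennreal_ofReal
    (hcm.ennreal_ofReal) hset, hac hc0] with x hx hcx
  rw [relSum_eq_toReal μ R F n hu0, relSum_eq_toReal μ R F n fun x => (hvpos x).le, hx,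
    ENNReal.toReal_mul, ENNReal.toReal_ofReal hcx]

theorem ae_relRatio_eq_condExp_of_measurable (e : ClassEnumeration μ R ι)
    (hsymm : ∀ x y, R x y → R y x)
    {n : ℕ} (hF : IsFiniteSubrelation R (F n)) {u v : B → ℝ}
    (hum : Measurable u) (hu : Integrable u μ)
    (hvm : Measurable v) (hv : Integrable v μ) (hvpos : ∀ x, 0 < v x) :
    ∀ᵐ x ∂μ, relRatio μ R F n u v x =
      ((μ.withDensity fun x => ENNReal.ofReal (v x))[fun x => u x / v x |
        invariantSigma fun x y => y ∈ F n x]) x := by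
  have hac : μ ≪ μ.withDensity fun x => ENNReal.ofReal (v x) :=
    withDensity_absolutelyContinuous' hvm.ennreal_ofReal.aemeasurable
      (Eventually.of_forall fun x => (ENNReal.ofReal_pos.2 (hvpos x)).ne')
  have hpm : Measurable fun x => max (u x) 0 := hum.max measurable_const
  have hnm : Measurable fun x => max (-u x) 0 := hum.neg.max measurable_const
  have hp := ae_relSum_eq_condExp_mul e hsymm hF hpm hu.pos_part
    (fun x => le_max_right _ _) hvm hv hvpos
  have hn := ae_relSum_eq_condExp_mul e hsymm hF hnm hu.neg_part
    (fun x => le_max_right _ _) hvm hv hvpos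
  have hsub := condExp_sub (integrable_div_withDensity hu.pos_part hvm.aemeasurable
    (Eventually.of_forall hvpos))
    (integrable_div_withDensity hu.neg_part hvm.aemeasurable (Eventually.of_forall hvpos))
    (invariantSigma fun x y => y ∈ F n x)
  have hdiff : (fun x => max (u x) 0 / v x) - (fun x => max (-u x) 0 / v x) =
      fun x => u x / v x := by
    funext x
    rw [Pi.sub_apply, ← sub_div, max_zero_sub_eq_self]
  rw [hdiff] at hsub
  filter_upwards [hp, hn, hac hsub, hF.ae_weighted_sum_ne_zero e hsymm hvm.ennreal_ofReal
    (fun x => (ENNReal.ofReal_pos.2 (hvpos x)).ne')] with x hp hn hsub hne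
  have hv0 : relSum μ R F n v x ≠ 0 := by
    rw [relSum_eq_toReal μ R F n fun x => (hvpos x).le]
    refine (ENNReal.toReal_pos hne ?_).ne'
    exact ENNReal.sum_ne_top.2
      fun y _ => ENNReal.mul_ne_top ENNReal.ofReal_ne_top ENNReal.ofReal_ne_top
  have hu' : relSum μ R F n u x = relSum μ R F n (fun x => max (u x) 0) x -
      relSum μ R F n (fun x => max (-u x) 0) x := by
    simp only [relSum, ← Finset.sum_sub_distrib, ← sub_mul]
    refine Finset.sum_congr rfl fun y _ => ?_
    congr 1
    rw [max_zero_sub_eq_self]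
  rw [relRatio, div_eq_iff hv0, hsub, hu', hp, hn, Pi.sub_apply, sub_mul]

/-- The ratio over a finite subrelation is the conditional expectation of `u / v` on its invariant sets.
Passing to measurable versions of `u` and `v`, the latter positive everywhere, changes the sums only
on a null set, because saturations of null sets are null. -/
theorem ae_relRatio_eq_condExp (e : ClassEnumeration μ R ι)
    (hsymm : ∀ x y, R x y → R y x)
    {n : ℕ} (hF : IsFiniteSubrelation R (F n)) {u v : B → ℝ}
    (hu : Integrable u μ) (hv : Integrable v μ) (hvpos : ∀ᵐ x ∂μ, 0 < v x) :
    ∀ᵐ x ∂μ, relRatio μ R F n u v x =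
      ((μ.withDensity fun x => ENNReal.ofReal (v x))[fun x => u x / v x |
        invariantSigma fun x y => y ∈ F n x]) x := by
  have hum : AEMeasurable u μ := hu.aemeasurable
  have hvm : AEMeasurable v μ := hv.aemeasurable
  let u' := hum.mk u
  -- On the null set where the measurable version of `v` is not positive, any positive value will do.
  let v' : B → ℝ := fun x => if 0 < hvm.mk v x then hvm.mk v x else 1
  have hv'm : Measurable v' := Measurable.ite (measurableSet_lt measurable_const hvm.measurable_mk)
    hvm.measurable_mk measurable_const
  have hv'pos : ∀ x, 0 < v' x := fun x => by
    by_cases h : 0 < hvm.mk v x <;> simp [v', h]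
  have huu' : u =ᵐ[μ] u' := hum.ae_eq_mk
  have hvv' : v =ᵐ[μ] v' := by
    filter_upwards [hvm.ae_eq_mk, hvpos] with x h1 h2
    rw [h1] at h2
    simp [v', h2, h1]
  have hκ : μ.withDensity (fun x => ENNReal.ofReal (v x)) =
      μ.withDensity fun x => ENNReal.ofReal (v' x) :=
    withDensity_congr_ae (hvv'.mono fun x h => by simp only [h])
  have hac : μ ≪ μ.withDensity fun x => ENNReal.ofReal (v' x) :=
    withDensity_absolutelyContinuous' hv'm.ennreal_ofReal.aemeasurable
      (Eventually.of_forall fun x => (ENNReal.ofReal_pos.2 (hv'pos x)).ne')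
  have hcond := condExp_congr_ae (m := invariantSigma fun x y => y ∈ F n x)
    (μ := μ.withDensity fun x => ENNReal.ofReal (v' x))
    ((withDensity_absolutelyContinuous μ _).ae_le (huu'.div hvv'))
  rw [hκ]
  filter_upwards [ae_relRatio_eq_condExp_of_measurable e hsymm hF hum.measurable_mk
    (hu.congr huu') hv'm (hv.congr hvv') hv'pos, hac hcond,
    e.ae_forall_rel huu', e.ae_forall_rel hvv'] with x hx hc hu hv
  refine Eq.trans ?_ (hx.trans hc.symm)
  have hsum : ∀ f g : B → ℝ, (∀ y, R x y → f y = g y) →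
      relSum μ R F n f x = relSum μ R F n g x := fun f g h =>
    Finset.sum_congr rfl fun y hy => by rw [h y (hF.rel x y hy)]
  rw [relRatio, relRatio, hsum u u' hu, hsum v v' hv]

/-- The ratio ergodic theorem for a relation exhausted by an increasing sequence of finite subrelations. -/
theorem tendsto_relRatio (e : ClassEnumeration μ R ι)
    (hsymm : ∀ x y, R x y → R y x) (hF : ∀ n, IsFiniteSubrelation R (F n))
    (hmono : ∀ x, Monotone fun n => F n x) (hR : ∀ x y, R x y → ∃ n, y ∈ F n x)
    {u v : B → ℝ}
    (hu : Integrable u μ) (hv : Integrable v μ) (hvpos : ∀ᵐ x ∂μ, 0 < v x) :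
    ∀ᵐ x ∂μ, Tendsto (fun n => relRatio μ R F n u v x) atTop
      (𝓝 (((μ.withDensity fun x => ENNReal.ofReal (v x))[fun x => u x / v x |
        invariantSigma R]) x)) := by
  have hac : μ ≪ μ.withDensity fun x => ENNReal.ofReal (v x) :=
    withDensity_absolutelyContinuous' hv.aemeasurable.ennreal_ofReal
      (hvpos.mono fun x hx => (ENNReal.ofReal_pos.2 hx).ne')
  have hfin := isFiniteMeasure_withDensity_ofReal hv.2
  have hint := integrable_div_withDensity hu hv.aemeasurable hvpos
  have hanti : Antitone fun n => invariantSigma (fun x y => y ∈ F n x) :=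
    fun a b hab s hs => ⟨hs.1, fun x y hxy => hs.2 x y (hmono x hab hxy)⟩
  have hlim := tendsto_ae_condExp_of_antitone (fun n => invariantSigma_le _) hanti hint
  rw [iInf_invariantSigma fun x y => ⟨hR x y, fun ⟨n, h⟩ => (hF n).rel x y h⟩] at hlim
  filter_upwards [hac hlim, ae_all_iff.2 fun n => ae_relRatio_eq_condExp e hsymm (hF n)
    hu hv hvpos] with x h1 h2
  simpa only [h2] using h1

end Ratio

/-! ### Cylinders of the boundary -/

theorem measurable_letter {r : ℕ} (i : ℕ) : Measurable fun ξ : Boundary r => ξ.1 i :=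
  (measurable_pi_apply i).comp measurable_subtype_coe

instance boundary_measurableEq (r : ℕ) : MeasurableEq (Boundary r) := by
  constructor
  have : Set.diagonal (Boundary r) = ⋂ i, {p | p.1.1 i = p.2.1 i} := by
    ext p
    simp [Subtype.ext_iff, funext_iff]
  rw [this]
  exact MeasurableSet.iInter fun i => measurableSet_eq_fun
    ((measurable_letter i).comp measurable_fst) ((measurable_letter i).comp measurable_snd)

/-- The cylinder of the first `n + 1` letters of `ξ`. Indexing cylinders by points of the boundary
makes all of them nonempty, and every prefix reduced. -/
def prefixCylinder {r : ℕ} (n : ℕ) (ξ : Boundary r) : Set (Boundary r) := {η | ∀ i ≤ n, η.1 i = ξ.1 i}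

theorem measurableSet_prefixCylinder {r : ℕ} (n : ℕ) (ξ : Boundary r) :
    MeasurableSet (prefixCylinder n ξ) := by
  have : prefixCylinder n ξ = ⋂ i, ⋂ (_ : i ≤ n), {η : Boundary r | η.1 i = ξ.1 i} := by
    ext; simp [prefixCylinder]
  rw [this]
  exact MeasurableSet.iInter fun i => MeasurableSet.iInter fun _ =>
    measurable_letter i (measurableSet_singleton _)

theorem countable_prefixCylinders (r : ℕ) :
    {s : Set (Boundary r) | ∃ n ≥ 1, ∃ ξ, prefixCylinder n ξ = s}.Countable := by
  refine (Set.countable_range fun p : Σ n : ℕ, Fin (n + 1) → Letter r =>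
    {η : Boundary r | ∀ i : Fin (p.1 + 1), η.1 i = p.2 i}).mono ?_
  rintro _ ⟨n, -, ξ, rfl⟩
  refine ⟨⟨n, fun i => ξ.1 i⟩, ?_⟩
  ext η
  exact ⟨fun h i hi => h ⟨i, Nat.lt_succ_of_le hi⟩,
    fun h i => h i (Nat.le_of_lt_succ i.2)⟩

theorem prefixCylinder_eq_of_mem {r : ℕ} {n : ℕ} {ξ η : Boundary r} (h : η ∈ prefixCylinder n ξ) :
    prefixCylinder n η = prefixCylinder n ξ := by
  ext ζ
  exact forall₂_congr fun i hi => by rw [h i hi]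

theorem prefixCylinder_anti {r : ℕ} {m n : ℕ} (h : m ≤ n) (ξ : Boundary r) :
    prefixCylinder n ξ ⊆ prefixCylinder m ξ := fun _ hη i hi => hη i (hi.trans h)

/-- Only cylinders of words of length at least two are used (`n ≥ 1`), since the preimage under a letter
`s` of the cylinder of the word `s` is not a cylinder. -/
theorem isPiSystem_prefixCylinders (r : ℕ) :
    IsPiSystem {s : Set (Boundary r) | ∃ n ≥ 1, ∃ ξ, prefixCylinder n ξ = s} := by
  rintro _ ⟨m, hm, ξ, rfl⟩ _ ⟨n, hn, η, rfl⟩ ⟨ζ, hζ, hζ'⟩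
  refine ⟨max m n, hm.trans (le_max_left _ _), ζ, ?_⟩
  rw [← prefixCylinder_eq_of_mem hζ, ← prefixCylinder_eq_of_mem hζ']
  ext ω
  constructor
  · exact fun h => ⟨prefixCylinder_anti (le_max_left _ _) _ h, prefixCylinder_anti (le_max_right _ _) _ h⟩
  · rintro ⟨h1, h2⟩ i hi
    rcases le_max_iff.1 hi with h | h
    exacts [h1 i h, h2 i h]

theorem generateFrom_prefixCylinders (r : ℕ) :
    (inferInstance : MeasurableSpace (Boundary r)) =
      MeasurableSpace.generateFrom {s | ∃ n ≥ 1, ∃ ξ, prefixCylinder n ξ = s} := by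
  refine le_antisymm ?_ ?_
  · refine (measurable_iff_comap_le (m₁ := MeasurableSpace.generateFrom _)).1 ?_
    refine (@measurable_pi_iff _ _ _ (MeasurableSpace.generateFrom _) _ _).2 fun i =>
      @measurable_to_countable' _ _ _ _ (MeasurableSpace.generateFrom _) _ fun a => ?_
    have : (fun ξ : Boundary r => ξ.1 i) ⁻¹' {a} =
        ⋃₀ {s | (∃ n ≥ 1, ∃ ξ, prefixCylinder n ξ = s) ∧ s ⊆ (fun ξ => ξ.1 i) ⁻¹' {a}} := by
      ext ξ
      constructor
      · intro h
        refine ⟨prefixCylinder (i + 1) ξ, ⟨⟨i + 1, by omega, ξ, rfl⟩, fun η hη => ?_⟩, fun _ _ => rfl⟩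
        exact (hη i (by omega)).trans h
      · rintro ⟨s, ⟨-, hs⟩, h⟩
        exact hs h
    rw [this]
    exact MeasurableSet.sUnion ((countable_prefixCylinders r).mono fun s hs => hs.1)
      fun s hs => MeasurableSpace.measurableSet_generateFrom hs.1
  · refine MeasurableSpace.generateFrom_le ?_
    rintro _ ⟨n, -, ξ, rfl⟩
    exact measurableSet_prefixCylinder n ξ

theorem Boundary.measure_ext {r : ℕ} {ρ₁ ρ₂ : Measure (Boundary r)} [IsFiniteMeasure ρ₁]
    (h : ∀ n ≥ 1, ∀ ξ, ρ₁ (prefixCylinder n ξ) = ρ₂ (prefixCylinder n ξ)) : ρ₁ = ρ₂ := by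
  refine Measure.ext_of_generateFrom_of_cover_subset (generateFrom_prefixCylinders r)
    (isPiSystem_prefixCylinders r) subset_rfl (countable_prefixCylinders r) ?_
    (fun s _ => measure_ne_top _ _) ?_
  · exact Set.eq_univ_of_forall fun ξ => ⟨prefixCylinder 1 ξ, ⟨1, le_rfl, ξ, rfl⟩, fun _ _ => rfl⟩
  · rintro _ ⟨n, hn, ξ, rfl⟩
    exact h n hn ξ

/-! ### Quasi-invariance of the Markov measure -/

theorem isProbabilityMeasure_boundaryMeasure {r : ℕ} (hr : r ≠ 0) :
    IsProbabilityMeasure (boundaryMeasure r) := by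
  have : Nonempty (Letter r) := ⟨(⟨0, Nat.pos_of_ne_zero hr⟩, true)⟩
  have h1 : IsProbabilityMeasure (ProbabilityTheory.uniformOn (Set.univ : Set (Letter r))) :=
    ProbabilityTheory.isProbabilityMeasure_uniformOn Set.finite_univ Set.univ_nonempty
  have h2 : IsProbabilityMeasure
      (ProbabilityTheory.uniformOn (Set.univ : Set (Fin (2 * (r - 1) + 1)))) :=
    ProbabilityTheory.isProbabilityMeasure_uniformOn Set.finite_univ Set.univ_nonempty
  exact Measure.isProbabilityMeasure_map measurable_path.aemeasurable

theorem boundaryMeasure_prefixCylinder {r : ℕ} (n : ℕ) (ξ : Boundary r) :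
    boundaryMeasure r (prefixCylinder n ξ) =
      ((2 * r : ℕ) : ℝ≥0∞)⁻¹ * (((2 * r - 1 : ℕ) : ℝ≥0∞)⁻¹) ^ n :=
  boundaryMeasure_cylinder ξ.1 n fun i _ => ξ.2 i

theorem letterAct_of_eq {r : ℕ} {s : Letter r} {ξ : Boundary r} (h : ξ.1 0 = letterInv s)
    (i : ℕ) : (letterAct s ξ).1 i = ξ.1 (i + 1) := by
  rw [letterAct, dif_pos h]

theorem letterAct_zero_of_ne {r : ℕ} {s : Letter r} {ξ : Boundary r} (h : ξ.1 0 ≠ letterInv s) :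
    (letterAct s ξ).1 0 = s := by
  simp [letterAct, h]

theorem letterAct_succ_of_ne {r : ℕ} {s : Letter r} {ξ : Boundary r} (h : ξ.1 0 ≠ letterInv s)
    (i : ℕ) : (letterAct s ξ).1 (i + 1) = ξ.1 i := by
  rw [letterAct, dif_neg h]

theorem measurable_letterAct {r : ℕ} (s : Letter r) : Measurable (letterAct s) := by
  have hset : MeasurableSet {ξ : Boundary r | ξ.1 0 = letterInv s} :=
    measurable_letter 0 (measurableSet_singleton _)
  have h : Measurable fun ξ : Boundary r => (letterAct s ξ).1 := by
    refine measurable_pi_iff.2 fun i => ?_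
    have heq : (fun ξ : Boundary r => (letterAct s ξ).1 i) = fun ξ =>
        if ξ.1 0 = letterInv s then ξ.1 (i + 1) else Nat.casesOn i s ξ.1 := by
      funext ξ
      by_cases h : ξ.1 0 = letterInv s <;> simp [letterAct, h]
    rw [heq]
    refine Measurable.ite hset (measurable_letter _) ?_
    cases i with
    | zero => exact measurable_const
    | succ i => exact measurable_letter i
  exact h.subtype_mk

/-- If `ξ` starts with `s`, then pulling back by `s` deletes that letter from the prefix. -/
theorem preimage_prefixCylinder_of_eq {r : ℕ} {s : Letter r} {ξ : Boundary r} (h : ξ.1 0 = s) (n : ℕ) :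
    letterAct s ⁻¹' prefixCylinder (n + 1) ξ = prefixCylinder n (letterAct (letterInv s) ξ) := by
  have h' : ξ.1 0 = letterInv (letterInv s) := h.trans (letterInv_letterInv s).symm
  ext η
  constructor
  · intro hη i hi
    have hne : η.1 0 ≠ letterInv s := by
      intro h0
      have h1 := hη 0 (Nat.zero_le _)
      rw [letterAct_of_eq h0, h] at h1
      exact η.2 0 (by rw [h1, h0, letterInv_letterInv])
    rw [letterAct_of_eq h', ← hη (i + 1) (by omega), letterAct_succ_of_ne hne]
  · intro hη i hi
    have hne : η.1 0 ≠ letterInv s := by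
      rw [hη 0 (Nat.zero_le _), letterAct_of_eq h', ← h]
      exact ξ.2 0
    cases i with
    | zero => rw [letterAct_zero_of_ne hne, h]
    | succ i => rw [letterAct_succ_of_ne hne, hη i (by omega), letterAct_of_eq h']

/-- If `ξ` does not start with `s`, then pulling back by `s` puts `s⁻¹` in front of the prefix. -/
theorem preimage_prefixCylinder_of_ne {r : ℕ} {s : Letter r} {ξ : Boundary r} (h : ξ.1 0 ≠ s)
    {n : ℕ} :
    letterAct s ⁻¹' prefixCylinder n ξ = prefixCylinder (n + 1) (letterAct (letterInv s) ξ) := by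
  have h' : ξ.1 0 ≠ letterInv (letterInv s) := by rwa [letterInv_letterInv]
  ext η
  constructor
  · intro hη
    have h0 : η.1 0 = letterInv s := by
      by_contra hne
      have h1 := hη 0 (Nat.zero_le _)
      rw [letterAct_zero_of_ne hne] at h1
      exact h h1.symm
    intro i hi
    cases i with
    | zero => rw [h0, letterAct_zero_of_ne h']
    | succ i => rw [letterAct_succ_of_ne h', ← hη i (by omega), letterAct_of_eq h0]
  · intro hη i hi
    have h0 : η.1 0 = letterInv s := by rw [hη 0 (Nat.zero_le _), letterAct_zero_of_ne h']
    rw [letterAct_of_eq h0, hη (i + 1) (by omega), letterAct_succ_of_ne h']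

/-- A letter `s` shortens or lengthens prefixes by one letter, so its push-forward of `ν` has density
`2 r - 1` on the words that start with `s` and `(2 r - 1)⁻¹` on the others. -/
theorem map_letterAct_boundaryMeasure {r : ℕ} (s : Letter r) :
    (boundaryMeasure r).map (letterAct s) =
      ((2 * r - 1 : ℕ) : ℝ≥0∞) • (boundaryMeasure r).restrict {ξ | ξ.1 0 = s} +
      ((2 * r - 1 : ℕ) : ℝ≥0∞)⁻¹ • (boundaryMeasure r).restrict {ξ | ξ.1 0 ≠ s} := by
  have hr : 0 < r := s.1.pos
  have := isProbabilityMeasure_boundaryMeasure hr.ne'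
  have hq0 : ((2 * r - 1 : ℕ) : ℝ≥0∞) ≠ 0 := by
    rw [Nat.cast_ne_zero]; omega
  refine Boundary.measure_ext fun n hn ξ => ?_
  have hcyl := measurableSet_prefixCylinder n ξ
  rw [Measure.map_apply (measurable_letterAct s) hcyl, Measure.add_apply, Measure.smul_apply,
    Measure.smul_apply, Measure.restrict_apply hcyl, Measure.restrict_apply hcyl]
  by_cases h : ξ.1 0 = s
  · have h1 : prefixCylinder n ξ ∩ {ξ | ξ.1 0 = s} = prefixCylinder n ξ :=
      Set.inter_eq_left.2 fun η hη => (hη 0 (Nat.zero_le _)).trans h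
    have h2 : prefixCylinder n ξ ∩ {ξ | ξ.1 0 ≠ s} = ∅ :=
      Set.eq_empty_of_forall_notMem fun η hη => hη.2 ((hη.1 0 (Nat.zero_le _)).trans h)
    obtain ⟨m, rfl⟩ : ∃ m, n = m + 1 := ⟨n - 1, by omega⟩
    rw [h1, h2, preimage_prefixCylinder_of_eq h, boundaryMeasure_prefixCylinder, boundaryMeasure_prefixCylinder,
      measure_empty, smul_zero, add_zero, smul_eq_mul, pow_succ]
    calc _ = ((2 * r : ℕ) : ℝ≥0∞)⁻¹ * (((2 * r - 1 : ℕ) : ℝ≥0∞)⁻¹) ^ m *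
          (((2 * r - 1 : ℕ) : ℝ≥0∞) * ((2 * r - 1 : ℕ) : ℝ≥0∞)⁻¹) := by
          rw [ENNReal.mul_inv_cancel hq0 (ENNReal.natCast_ne_top _), mul_one]
      _ = _ := by ring
  · have h1 : prefixCylinder n ξ ∩ {ξ | ξ.1 0 = s} = ∅ :=
      Set.eq_empty_of_forall_notMem fun η hη => h ((hη.1 0 (Nat.zero_le _)).symm.trans hη.2)
    have h2 : prefixCylinder n ξ ∩ {ξ | ξ.1 0 ≠ s} = prefixCylinder n ξ :=
      Set.inter_eq_left.2 fun η hη h' => h ((hη 0 (Nat.zero_le _)).symm.trans h')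
    rw [h1, h2, preimage_prefixCylinder_of_ne h, boundaryMeasure_prefixCylinder, boundaryMeasure_prefixCylinder,
      measure_empty, smul_zero, zero_add, smul_eq_mul, pow_succ]
    ring

theorem quasiMeasurePreserving_letterAct {r : ℕ} (s : Letter r) :
    Measure.QuasiMeasurePreserving (letterAct s) (boundaryMeasure r) (boundaryMeasure r) := by
  refine ⟨measurable_letterAct s, ?_⟩
  rw [map_letterAct_boundaryMeasure]
  exact Measure.AbsolutelyContinuous.add_left
    (Measure.restrict_le_self.absolutelyContinuous.smul_left _)
    (Measure.restrict_le_self.absolutelyContinuous.smul_left _)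

theorem quasiMeasurePreserving_boundaryAction {r : ℕ} (g : FreeGroup (Fin r)) :
    Measure.QuasiMeasurePreserving (boundaryAction r g) (boundaryMeasure r)
      (boundaryMeasure r) := by
  obtain ⟨L, rfl⟩ := Quot.exists_rep g
  change Measure.QuasiMeasurePreserving (boundaryAction r (FreeGroup.mk L)) _ _
  induction L with
  | nil =>
    rw [← FreeGroup.one_eq_mk, map_one]
    exact Measure.QuasiMeasurePreserving.id _
  | cons s L ih =>
    have hact : ⇑(boundaryAction r (FreeGroup.mk (s :: L))) =
        letterAct s ∘ boundaryAction r (FreeGroup.mk L) := by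
      funext ξ
      rw [← List.singleton_append, ← FreeGroup.mul_mk, map_mul, Equiv.Perm.mul_apply,
        boundaryAction_letter, Function.comp_apply]
    rw [hact]
    exact (quasiMeasurePreserving_letterAct s).comp ih

theorem quasiMeasurePreserving_prodMap {α β : Type*} [MeasurableSpace α] [MeasurableSpace β]
    {μ : Measure α} {ν : Measure β} [SFinite μ] [SFinite ν] {f : α → α} {g : β → β}
    (hf : Measure.QuasiMeasurePreserving f μ μ) (hg : Measure.QuasiMeasurePreserving g ν ν) :
    Measure.QuasiMeasurePreserving (Prod.map f g) (μ.prod ν) (μ.prod ν) := by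
  refine ⟨hf.measurable.prodMap hg.measurable, ?_⟩
  rw [← Measure.map_prod_map _ _ hf.measurable hg.measurable]
  exact hf.absolutelyContinuous.prod hg.absolutelyContinuous

/-! ### The tail relation and its extension -/

theorem TailRel.symm {r : ℕ} {ξ η : Boundary r} (h : TailRel ξ η) : TailRel η ξ :=
  h.imp fun _ hN n hn => (hN n hn).symm

theorem tailCocycle_self {r : ℕ} (ξ : Boundary r) : tailCocycle ξ ξ = 1 := by
  rw [tailCocycle_eq (N := 0) fun _ _ => rfl, mul_inv_cancel]

theorem tailCocycle_mul {r : ℕ} {ξ η ζ : Boundary r} (h₁ : TailRel ξ η) (h₂ : TailRel η ζ) :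
    tailCocycle ξ η * tailCocycle η ζ = tailCocycle ξ ζ := by
  obtain ⟨N, hN⟩ := h₁
  obtain ⟨M, hM⟩ := h₂
  have h1 : ∀ n ≥ max N M, ξ.1 n = η.1 n := fun n hn => hN n ((le_max_left _ _).trans hn)
  have h2 : ∀ n ≥ max N M, η.1 n = ζ.1 n := fun n hn => hM n ((le_max_right _ _).trans hn)
  rw [tailCocycle_eq h1, tailCocycle_eq h2,
    tailCocycle_eq fun n hn => (h1 n hn).trans (h2 n hn)]
  group

theorem measurableSet_agree_and_prefixElt {r : ℕ} (N : ℕ) (g : FreeGroup (Fin r)) :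
    MeasurableSet {p : Boundary r × Boundary r | (∀ n ≥ N, p.1.1 n = p.2.1 n) ∧
      prefixElt p.1 N * (prefixElt p.2 N)⁻¹ = g} := by
  rw [Set.ofPred_and]
  refine MeasurableSet.inter ?_ ?_
  · have : {p : Boundary r × Boundary r | ∀ n ≥ N, p.1.1 n = p.2.1 n} =
        ⋂ n, ⋂ (_ : n ≥ N), {p | p.1.1 n = p.2.1 n} := by
      ext; simp
    rw [this]
    exact MeasurableSet.iInter fun n => MeasurableSet.iInter fun _ => measurableSet_eq_fun
      ((measurable_letter n).comp measurable_fst) ((measurable_letter n).comp measurable_snd)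
  · let w : Boundary r → Fin N → Letter r := fun ξ i => ξ.1 i
    have hw : Measurable w := measurable_pi_iff.2 fun i => measurable_letter i
    have hpre : ∀ ξ, prefixElt ξ N = FreeGroup.mk (List.ofFn (w ξ)) := fun ξ => by
      rw [prefixElt, List.ofFn_eq_map, ← List.map_coe_finRange_eq_range, List.map_map]
      rfl
    simp only [hpre]
    exact ((hw.comp measurable_fst).prodMk (hw.comp measurable_snd))
      (MeasurableSet.of_discrete (s := {q : (Fin N → Letter r) × (Fin N → Letter r) |
        FreeGroup.mk (List.ofFn q.1) * (FreeGroup.mk (List.ofFn q.2))⁻¹ = g}))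

theorem measurableSet_tailRel_and_tailCocycle {r : ℕ} (g : FreeGroup (Fin r)) :
    MeasurableSet {p : Boundary r × Boundary r | TailRel p.1 p.2 ∧ tailCocycle p.1 p.2 = g} := by
  have : {p : Boundary r × Boundary r | TailRel p.1 p.2 ∧ tailCocycle p.1 p.2 = g} =
      ⋃ N, {p | (∀ n ≥ N, p.1.1 n = p.2.1 n) ∧
        prefixElt p.1 N * (prefixElt p.2 N)⁻¹ = g} := by
    ext p
    simp only [Set.mem_ofPred_eq, Set.mem_iUnion]
    constructor
    · rintro ⟨⟨N, hN⟩, h⟩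
      exact ⟨N, hN, by rw [← tailCocycle_eq hN, h]⟩
    · rintro ⟨N, hN, h⟩
      exact ⟨⟨N, hN⟩, by rw [tailCocycle_eq hN, h]⟩
  rw [this]
  exact MeasurableSet.iUnion fun N => measurableSet_agree_and_prefixElt N g

section Extension

variable {r : ℕ} {X : Type*} [MulAction (FreeGroup (Fin r)) X]

theorem extRel_tail_symm {p q : Boundary r × X} (h : extRel TailRel tailCocycle p q) :
    extRel TailRel tailCocycle q p := by
  refine ⟨h.1.symm, ?_⟩
  rw [← h.2, smul_smul, tailCocycle_mul h.1 h.1.symm, tailCocycle_self, one_smul]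

theorem mem_extSubset_horo {n : ℕ} {p q : Boundary r × X} :
    q ∈ extSubset tailCocycle (horoSubset r) n p ↔
      (∀ k ≥ n, q.1.1 k = p.1.1 k) ∧ tailCocycle q.1 p.1 • p.2 = q.2 := by
  simp only [extSubset, Finset.mem_map, horoSubset, Set.Finite.mem_toFinset, Set.mem_ofPred_eq]
  constructor
  · rintro ⟨η, hη, rfl⟩
    exact ⟨hη, rfl⟩
  · rintro ⟨h1, h2⟩
    exact ⟨q.1, h1, Prod.ext rfl h2⟩

variable [MeasurableSpace X]

/-- The class of `(ξ, x)` in the extended relation, enumerated by the free group: `g` stands for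
`(g ξ, g x)` and is admitted iff `(g ξ, ξ) ∈ R₀` and `α(g ξ, ξ) = g`. The second condition picks a
single `g` even if `ξ` has a nontrivial stabilizer. -/
noncomputable def tailEnumeration (hr : r ≠ 0) (lam : Measure X) [SFinite lam]
    (hact : ∀ g : FreeGroup (Fin r), Measure.QuasiMeasurePreserving (fun x : X => g • x) lam lam) :
    ClassEnumeration ((boundaryMeasure r).prod lam) (extRel (X := X) TailRel tailCocycle)
      (FreeGroup (Fin r)) where
  map g := Prod.map (boundaryAction r g) (g • ·)
  dom g := {p | TailRel (boundaryAction r g p.1) p.1 ∧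
    tailCocycle (boundaryAction r g p.1) p.1 = g}
  measurableSet_dom g :=
    (((quasiMeasurePreserving_boundaryAction g).measurable.comp measurable_fst).prodMk
      measurable_fst) (measurableSet_tailRel_and_tailCocycle g)
  quasi g := by
    have := isProbabilityMeasure_boundaryMeasure hr
    exact quasiMeasurePreserving_prodMap (quasiMeasurePreserving_boundaryAction g) (hact g)
  rel_iff p q := by
    constructor
    · rintro ⟨h1, h2⟩
      have h3 := boundaryAction_tailCocycle h1.symm
      refine ⟨tailCocycle q.1 p.1, ⟨?_, ?_⟩, Prod.ext h3 h2⟩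
      · rw [h3]; exact h1.symm
      · rw [h3]
    · rintro ⟨g, ⟨h1, h2⟩, rfl⟩
      exact ⟨h1.symm, congrArg (· • p.2) h2⟩
  inj p g h hg hh heq := by
    have h1 : boundaryAction r g p.1 = boundaryAction r h p.1 := congrArg Prod.fst heq
    rw [← hg.2, h1, hh.2]

theorem isFiniteSubrelation_extSubset_horo [MeasurableEq X]
    (hact : ∀ g : FreeGroup (Fin r), Measurable (fun x : X => g • x)) (n : ℕ) :
    IsFiniteSubrelation (extRel (X := X) TailRel tailCocycle)
      (extSubset tailCocycle (horoSubset r) n) where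
  rel p q hq := by
    rw [mem_extSubset_horo] at hq
    exact ⟨TailRel.symm ⟨n, hq.1⟩, hq.2⟩
  measurableSet := by
    have : {p : (Boundary r × X) × (Boundary r × X) |
          p.2 ∈ extSubset tailCocycle (horoSubset r) n p.1} =
        ⋃ g : FreeGroup (Fin r), {p | ((∀ k ≥ n, p.2.1.1 k = p.1.1.1 k) ∧
          prefixElt p.2.1 n * (prefixElt p.1.1 n)⁻¹ = g) ∧ g • p.1.2 = p.2.2} := by
      ext p
      simp only [Set.mem_ofPred_eq, Set.mem_iUnion, mem_extSubset_horo]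
      constructor
      · rintro ⟨h1, h2⟩
        exact ⟨_, ⟨h1, (tailCocycle_eq h1).symm⟩, h2⟩
      · rintro ⟨g, ⟨h1, h2⟩, h3⟩
        exact ⟨h1, by rw [tailCocycle_eq h1, h2, h3]⟩
    rw [this]
    refine MeasurableSet.iUnion fun g => MeasurableSet.inter ?_ ?_
    · exact ((measurable_fst.comp measurable_snd).prodMk (measurable_fst.comp measurable_fst))
        (measurableSet_agree_and_prefixElt n g)
    · exact measurableSet_eq_fun ((hact g).comp (measurable_snd.comp measurable_fst))
        (measurable_snd.comp measurable_snd)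
  self_mem p := by
    rw [mem_extSubset_horo]
    exact ⟨fun _ _ => rfl, by rw [tailCocycle_self, one_smul]⟩
  eq_of_mem p q hq := by
    rw [mem_extSubset_horo] at hq
    ext z
    rw [mem_extSubset_horo, mem_extSubset_horo]
    have hagree : (∀ k ≥ n, z.1.1 k = q.1.1 k) ↔ ∀ k ≥ n, z.1.1 k = p.1.1 k :=
      forall₂_congr fun k hk => by rw [hq.1 k hk]
    rw [hagree]
    refine and_congr_right fun h => ?_
    rw [← hq.2, smul_smul, tailCocycle_mul ⟨n, hagree.2 h⟩ ⟨n, hq.1⟩]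

end Extension

theorem mainTheorem6 (r : ℕ) (hr : 2 ≤ r)
    {X : Type*} [MeasurableSpace X] [StandardBorelSpace X]
    (lam : Measure X) [SigmaFinite lam]
    [MulAction (FreeGroup (Fin r)) X]
    (hact : ∀ g : FreeGroup (Fin r), Measure.QuasiMeasurePreserving (fun x : X => g • x) lam lam)
    (u v : Boundary r × X → ℝ)
    (hu : Integrable u ((boundaryMeasure r).prod lam))
    (hv : Integrable v ((boundaryMeasure r).prod lam))
    (hv_pos : ∀ᵐ p ∂((boundaryMeasure r).prod lam), 0 < v p) :
    ∀ᵐ p ∂((boundaryMeasure r).prod lam),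
      Tendsto
        (fun n => relRatio ((boundaryMeasure r).prod lam)
          (extRel (X := X) TailRel tailCocycle) (extSubset tailCocycle (horoSubset r)) n u v p)
        atTop
        (𝓝 ((((boundaryMeasure r).prod lam).withDensity fun q => ENNReal.ofReal (v q))[
          fun q => u q / v q | invariantSigma (extRel (X := X) TailRel tailCocycle)] p)) := by
  have hr0 : r ≠ 0 := by omega
  have := isProbabilityMeasure_boundaryMeasure hr0
  have : MeasurableEq (Boundary r × X) := by
    constructor
    have hd : Set.diagonal (Boundary r × X) = {p | p.1.1 = p.2.1} ∩ {p | p.1.2 = p.2.2} := by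
      ext p
      exact Prod.ext_iff
    rw [hd]
    exact (measurableSet_eq_fun (measurable_fst.comp measurable_fst)
      (measurable_fst.comp measurable_snd)).inter
      (measurableSet_eq_fun (measurable_snd.comp measurable_fst)
        (measurable_snd.comp measurable_snd))
  refine tendsto_relRatio (tailEnumeration hr0 lam hact) (fun p q => extRel_tail_symm)
    (isFiniteSubrelation_extSubset_horo fun g => (hact g).measurable) ?_ ?_ hu hv hv_pos
  · intro p m n hmn q hq
    rw [mem_extSubset_horo] at hq ⊢
    exact ⟨fun k hk => hq.1 k (hmn.trans hk), hq.2⟩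
  · rintro p q ⟨⟨N, hN⟩, h⟩
    exact ⟨N, mem_extSubset_horo.2 ⟨fun k hk => (hN k hk).symm, h⟩⟩
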